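/- Let $(X,d)$ be a complete separable metric space and let $E:X\to\mathbb R\cup\{+\infty\}$ be lower semicontinuous, with dense domain $D(E)=\{E<\infty\}$, and bounded from below on every $d$-bounded set. Assume that for some $\lambda\in\mathbb R$ every $x\in X$ is the starting point of an $\mathrm{EVI}_\lambda$-gradient flow of $E$, that is, of a locally absolutely continuous curve $(\gamma_t)_{t>0}$ in $X$ with $\gamma_t\to x$ as $t\downarrow0$ such that, for every $z\in X$ and for a.e. $t>0$, $$\tfrac12\tfrac{d}{dt}d^2(\gamma_t,z)+\tfrac\lambda2 d^2(\gamma_t,z)+E(\gamma_t)\le E(z).$$ The slope of $E$ is $|\partial E|(x)=\limsup_{z\to x}\frac{[E(x)-E(z)]^+}{d(x,z)}$ if $x\in D(E)$ ($0$ if $x$ is isolated), and $|\partial E|(x)=+\infty$ if $x\notin D(E)$. Let $\sigma$ be a Hausdorff topology on $X$ such that every $d$-bounded sequence has a $\sigma$-convergent subsequence and such that $d$ (jointly in its two arguments) and $|\partial E|$ are sequentially $\sigma$-lower semicontinuous. For $\gamma\in C([0,1],X)$ set $\mathcal A(\gamma)=\frac12\int_0^1|\dot\gamma_t|^2\,dt$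 if $\gamma$ is absolutely continuous, where $|\dot\gamma_t|$ is the metric speed, and $\mathcal A(\gamma)=+\infty$ otherwise; set $\mathcal I(\gamma)=\frac12\int_0^1|\partial E|^2(\gamma_t)\,dt$. Given $x,y\in X$, write $\gamma:x\leadsto y$ if $\gamma\in C([0,1],X)$, $\gamma_0=x$, $\gamma_1=y$. For $\varepsilon>0$, the $\varepsilon$-Schrödinger problem between $x$ and $y$ is to minimize $\mathcal A(\gamma)+\varepsilon^2\mathcal I(\gamma)$ over $\gamma:x\leadsto y$; it is called solvable if its infimum is finite and attained. Assume that the $\varepsilon$-Schrödinger problem between $x$ and $y$ is solvable for some $\varepsilon>0$, and let $\varepsilon_k>0$ with $\varepsilon_k\to0$. Then $$\lim_{k\to\infty}\ \inf_{\gamma:x\leadsto y}\big\{\mathcal A(\gamma)+\varepsilon_k^2\mathcal I(\gamma)\big\}=\inf_{\gamma:x\leadsto y}\mathcal A(\gamma).$$ Moreover, if for every $k$ the curve $\omega^k:x\leadsto y$ is a minimizer of the $\varepsilon_k$-Schrödinger problem, then $$\lim_{k\to\infty}\big\{\mathcal A(\omega^k)+\varepsilon_k^2\mathcal I(\omega^k)\big\}=\inf_{\gamma:x\leadsto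 y}\mathcal A(\gamma),$$ and there exist a curve $\omega^0:x\leadsto y$ in $C([0,1],X)$ and a subsequence $(k_j)$ such that $\omega^{k_j}_t\to\omega^0_t$ with respect to $\sigma$ for every $t\in[0,1]$ and $$\mathcal A(\omega^0)=\inf_{\gamma:x\leadsto y}\mathcal A(\gamma).$$ -/

import Mathlib

open Set Filter Topology MeasureTheory
open scoped ENNReal

/-- The curves `C([0,1], X)`, continuous for the metric topology of `X`. -/
abbrev Curve (X : Type*) [MetricSpace X] : Type _ := C(unitInterval, X)

noncomputable section

namespace Curve

variable {X : Type*} [MetricSpace X]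

/-- The curve as a function on `ℝ`, extended by constants outside `[0,1]`. -/
def ext (γ : Curve X) : ℝ → X := Set.IccExtend zero_le_one (γ : unitInterval → X)

/-- The position `γ_t`. -/
def pos (γ : Curve X) (t : unitInterval) : X := γ t

/-- `γ` runs from `x` to `y`. -/
def Joins (γ : Curve X) (x y : X) : Prop := γ 0 = x ∧ γ 1 = y

end Curve

/-- The metric speed `|γ'|(t)`. It is written as a `limsup` of difference quotients; for an absolutely
continuous curve the limit exists at almost every time. -/
def metricSpeed {X : Type*} [MetricSpace X] (γ : ℝ → X) (t : ℝ) : ℝ≥0∞ :=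
  limsup (fun s : ℝ => edist (γ s) (γ t) / edist s t) (𝓝[≠] t)

/-- The descending slope `|∂E|(x)` of `E : X → ℝ ∪ {+∞}`: it is `+∞` outside the domain of `E`, and
otherwise the `limsup` of `[E x - E y]⁺ / d(x,y)` as `y → x`, `y ≠ x` (which is `0` at an isolated
point, where the filter `𝓝[≠] x` is trivial). -/
def metricSlope {X : Type*} [MetricSpace X] (E : X → EReal) (x : X) : ℝ≥0∞ :=
  if E x = ⊤ then ⊤
  else limsup (fun y : X => (E x - E y).toENNReal / edist x y) (𝓝[≠] x)

/-- The curve `(γ_t)_{t>0}` is an `EVI_lam`-gradient flow of `E` starting at `x`. Only the values at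
positive times matter. -/
structure IsEVIFlow {X : Type*} [MetricSpace X] (E : X → EReal) (lam : ℝ) (γ : ℝ → X) (x : X) :
    Prop where
  locally_ac : ∀ a b : ℝ, 0 < a → a ≤ b → AbsolutelyContinuousOnInterval γ a b
  evi : ∀ y : X, ∀ᵐ t ∂(volume.restrict (Ioi (0 : ℝ))),
    (((1 / 2) * deriv (fun s : ℝ => dist (γ s) y ^ 2) t + lam / 2 * dist (γ t) y ^ 2 : ℝ) : EReal)
      + E (γ t) ≤ E y
  starts : Tendsto γ (𝓝[>] (0 : ℝ)) (𝓝 x)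

/-- The standing assumptions on `E : X → ℝ ∪ {+∞}`: lower semicontinuity, dense domain, boundedness
from below on bounded sets, and existence of `EVI_lam`-gradient flows from every point, for some
real `lam`. -/
structure IsEVIFunctional {X : Type*} [MetricSpace X] (E : X → EReal) : Prop where
  ne_bot : ∀ x, E x ≠ ⊥
  lsc : LowerSemicontinuous E
  dense_domain : Dense {x | E x ≠ ⊤}
  bounded_below : ∀ B : Set X, Bornology.IsBounded B → ∃ c : ℝ, ∀ x ∈ B, (c : EReal) ≤ E x
  exists_flow : ∃ lam : ℝ, ∀ x : X, ∃ γ : ℝ → X, IsEVIFlow E lam γ x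

/-- The auxiliary topology `σ`: Hausdorff, every metrically bounded sequence has a `σ`-convergent
subsequence, and distance and slope are sequentially `σ`-lower semicontinuous. -/
structure IsAdmissibleTopology {X : Type*} [MetricSpace X] (E : X → EReal)
    (σ : TopologicalSpace X) : Prop where
  hausdorff : @T2Space X σ
  bounded_seq_compact : ∀ u : ℕ → X, Bornology.IsBounded (range u) →
    ∃ (z : X) (φ : ℕ → ℕ), StrictMono φ ∧ Tendsto (fun n => u (φ n)) atTop (@nhds X σ z)
  dist_lsc : ∀ (u v : ℕ → X) (a b : X), Tendsto u atTop (@nhds X σ a) →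
    Tendsto v atTop (@nhds X σ b) → edist a b ≤ liminf (fun n => edist (u n) (v n)) atTop
  slope_lsc : ∀ (u : ℕ → X) (a : X), Tendsto u atTop (@nhds X σ a) →
    metricSlope E a ≤ liminf (fun n => metricSlope E (u n)) atTop

section Problem

variable {X : Type*} [MetricSpace X]

open Classical in
/-- The kinetic action `𝓐(γ) = ½ ∫₀¹ |γ'|²`, equal to `+∞` if `γ` is not absolutely continuous. -/
def kineticAction (γ : Curve X) : ℝ≥0∞ :=
  if AbsolutelyContinuousOnInterval γ.ext 0 1 then
    2⁻¹ * ∫⁻ t in Icc (0 : ℝ) 1, metricSpeed γ.ext t ^ 2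
  else ⊤

/-- The halved Fisher information `𝓘(γ) = ½ ∫₀¹ |∂E|²(γ_t) dt`. -/
def fisherInformation (E : X → EReal) (γ : Curve X) : ℝ≥0∞ :=
  2⁻¹ * ∫⁻ t in Icc (0 : ℝ) 1, metricSlope E (γ.ext t) ^ 2

/-- `𝓐_ε(γ) = 𝓐(γ) + ε² 𝓘(γ)`. -/
def schrodingerAction (E : X → EReal) (ε : ℝ) (γ : Curve X) : ℝ≥0∞ :=
  kineticAction γ + ENNReal.ofReal (ε ^ 2) * fisherInformation E γ

/-- The infimum of the kinetic action over the curves from `x` to `y`. -/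
def kineticCost (x y : X) : ℝ≥0∞ :=
  ⨅ (γ : Curve X) (_ : γ.Joins x y), kineticAction γ

/-- The optimal value of the `ε`-Schrödinger problem between `x` and `y`. -/
def schrodingerCost (E : X → EReal) (ε : ℝ) (x y : X) : ℝ≥0∞ :=
  ⨅ (γ : Curve X) (_ : γ.Joins x y), schrodingerAction E ε γ

/-- `ω` attains the infimum in the `ε`-Schrödinger problem between `x` and `y`. -/
def IsSchrodingerMinimizer (E : X → EReal) (ε : ℝ) (x y : X) (ω : Curve X) : Prop :=
  ω.Joins x y ∧ schrodingerAction E ε ω = schrodingerCost E ε x y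

/-- The `ε`-Schrödinger problem between `x` and `y` is solvable: its infimum is finite and attained. -/
def SchrodingerSolvable (E : X → EReal) (ε : ℝ) (x y : X) : Prop :=
  schrodingerCost E ε x y ≠ ⊤ ∧ ∃ ω : Curve X, IsSchrodingerMinimizer E ε x y ω

/-- Pointwise-in-time convergence of curves for the topology `σ`. -/
def PointwiseTendsto (σ : TopologicalSpace X) (ω : ℕ → Curve X) (ω₀ : Curve X) : Prop :=
  ∀ t : unitInterval, Tendsto (fun k => (ω k).pos t) atTop (@nhds X σ (ω₀.pos t))

end Problem

end

/-! This is a Γ-convergence argument. The lower bound is free, since the Fisher term is nonnegative.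
For the upper bound, every curve of finite action from `x` to `y` has to be approximated by curves
of nearly the same action and of finite Fisher information; the term carrying the factor ε_k² then
vanishes (`exists_curve_kineticAction_lt`).

The approximation pushes the curve through the flow `U_s` for a short time `s`. The EVI makes `U_s`
Lipschitz with constant e^{-λs} (`IsEVIFlow.exp_mul_dist_le`), so the action changes by a factor
close to 1, and it bounds the slope on `U_s`-images of bounded sets
(`IsEVIFlow.exists_metricSlope_bound`). The displaced endpoints are reconnected by flow
trajectories, whose cost is controlled by the drop of `E` and along which the slope is at most the
speed (`IsEVIFlow.arcJoined`). This requires endpoints of finite energy, which `x` and `y` need not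
have; short end pieces of the Schrödinger minimizer given by solvability lead to such points.

Minimizers have kinetic actions converging to the infimum, hence are eventually equi-Hölder;
σ-compactness and lower semicontinuity of the distance yield the limit (`exists_limit_curve`). The
action is handled through `IsArc`, an inequality on increments that survives affine
reparametrization, concatenation, Lipschitz maps and pointwise σ-limits. -/

/-! ### Curves with controlled increments. -/

/-- `V` controls the square of the increments of `γ` on `[a, b]`. -/
def IsArc {X : Type*} [MetricSpace X] (γ : ℝ → X) (V : ℝ → ℝ) (a b : ℝ) : Prop :=
  ∀ s ∈ Icc a b, ∀ t ∈ Icc a b, dist (γ s) (γ t) ^ 2 ≤ (t - s) * (V t - V s)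

namespace IsArc

variable {X : Type*} [MetricSpace X] {γ : ℝ → X} {V : ℝ → ℝ} {a b : ℝ}

theorem monotoneOn (h : IsArc γ V a b) : MonotoneOn V (Icc a b) := by
  intro s hs t ht hst
  rcases hst.eq_or_lt with rfl | hst
  · exact le_rfl
  · have h1 := (sq_nonneg _).trans (h s hs t ht)
    have := nonneg_of_mul_nonneg_right h1 (sub_pos.2 hst)
    linarith

theorem mono {c d : ℝ} (h : IsArc γ V a b) (hs : Icc c d ⊆ Icc a b) : IsArc γ V c d :=
  fun s hs' t ht => h s (hs hs') t (hs ht)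

end IsArc

/-- The increments of a monotone function over disjoint intervals add up to at most the total
increment. -/
theorem MonotoneOn.sum_abs_sub_le {V : ℝ → ℝ} {a b : ℝ} (hab : a ≤ b)
    (hV : MonotoneOn V (Icc a b)) {n : ℕ} {I : ℕ → ℝ × ℝ}
    (hI : (n, I) ∈ AbsolutelyContinuousOnInterval.disjWithin a b) :
    ∑ i ∈ Finset.range n, |V (I i).2 - V (I i).1| ≤ V b - V a := by
  obtain ⟨hmem, hdis⟩ := hI
  rw [uIcc_of_le hab] at hmem
  simp only at hmem hdis
  have hVab : V a ≤ V b := hV (left_mem_Icc.2 hab) (right_mem_Icc.2 hab) hab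
  -- The increments of `V` are the lengths of these open intervals of values, which are disjoint and
  -- lie in `[V a, V b]`; the bound is then a comparison of Lebesgue measures.
  let J : ℕ → Set ℝ := fun i =>
    Ioo (min (V (I i).1) (V (I i).2)) (max (V (I i).1) (V (I i).2))
  have hmin : ∀ i ∈ Finset.range n, ∀ p ∈ J i,
      V (min (I i).1 (I i).2) < p ∧ p < V (max (I i).1 (I i).2) := by
    intro i hi p hp
    obtain ⟨h1, h2⟩ := hmem i hi
    rcases le_total (I i).1 (I i).2 with h | h
    · have := hV h1 h2 h
      simpa [J, h, this] using hp
    · have := hV h2 h1 h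
      simpa [J, h, this] using hp
  have hlt : ∀ i ∈ Finset.range n, ∀ p ∈ J i, min (I i).1 (I i).2 < max (I i).1 (I i).2 := by
    intro i hi p hp
    obtain ⟨h3, h4⟩ := hmin i hi p hp
    refine lt_of_le_of_ne min_le_max fun he => ?_
    rw [he] at h3
    linarith
  have hIccmin : ∀ i ∈ Finset.range n, min (I i).1 (I i).2 ∈ Icc a b ∧
      max (I i).1 (I i).2 ∈ Icc a b := by
    intro i hi
    obtain ⟨⟨h1, h2⟩, h3, h4⟩ := hmem i hi
    exact ⟨⟨le_min h1 h3, (min_le_left _ _).trans h2⟩, ⟨h1.trans (le_max_left _ _), max_le h2 h4⟩⟩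
  have hJdis : Set.PairwiseDisjoint (↑(Finset.range n)) J := by
    intro i hi j hj hij
    refine Set.disjoint_left.2 fun p hpi hpj => ?_
    obtain ⟨h1, h2⟩ := hmin i hi p hpi
    obtain ⟨h3, h4⟩ := hmin j hj p hpj
    have l1 := hlt i hi p hpi
    have l2 := hlt j hj p hpj
    obtain ⟨m1, m2⟩ := hIccmin i hi
    obtain ⟨m3, m4⟩ := hIccmin j hj
    have hd : Disjoint (Ioc _ _) (Ioc _ _) := hdis hi hj hij
    rw [Ioc_disjoint_Ioc] at hd
    have k1 : min (I i).1 (I i).2 < max (I j).1 (I j).2 := by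
      by_contra! hc
      linarith [hV m4 m1 hc]
    have k2 : min (I j).1 (I j).2 < max (I i).1 (I i).2 := by
      by_contra! hc
      linarith [hV m2 m3 hc]
    exact absurd hd (not_le.2 (max_lt (lt_min l1 k1) (lt_min k2 l2)))
  have hvol : volume (⋃ i ∈ Finset.range n, J i) = ∑ i ∈ Finset.range n, volume (J i) :=
    measure_biUnion_finset hJdis fun i _ => measurableSet_Ioo
  have hsub : (⋃ i ∈ Finset.range n, J i) ⊆ Icc (V a) (V b) := by
    refine iUnion₂_subset fun i hi p hp => ?_
    obtain ⟨h1, h2⟩ := hmin i hi p hp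
    obtain ⟨m1, m2⟩ := hIccmin i hi
    exact ⟨(hV (left_mem_Icc.2 hab) m1 m1.1).trans h1.le,
      h2.le.trans (hV m2 (right_mem_Icc.2 hab) m2.2)⟩
  have hle := measure_mono (μ := volume) hsub
  rw [hvol, Real.volume_Icc] at hle
  have hJ : ∀ i, volume (J i) = ENNReal.ofReal |V (I i).2 - V (I i).1| := by
    intro i
    simp only [J, Real.volume_Ioo]
    rw [max_sub_min_eq_abs]
  simp only [hJ] at hle
  rw [← ENNReal.ofReal_sum_of_nonneg fun i _ => abs_nonneg _] at hle
  exact (ENNReal.ofReal_le_ofReal_iff (sub_nonneg.2 hVab)).1 hle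

namespace IsArc

variable {X : Type*} [MetricSpace X] {γ : ℝ → X} {V : ℝ → ℝ} {a b : ℝ}

theorem absolutelyContinuousOnInterval (h : IsArc γ V a b) (hab : a ≤ b) :
    AbsolutelyContinuousOnInterval γ a b := by
  rw [absolutelyContinuousOnInterval_iff]
  intro ε hε
  have hVab : 0 ≤ V b - V a :=
    sub_nonneg.2 (h.monotoneOn (left_mem_Icc.2 hab) (right_mem_Icc.2 hab) hab)
  -- By Cauchy–Schwarz the squared sum of distances is at most the total length times `V b - V a`;
  -- the `+ 1` keeps the denominator positive.
  refine ⟨ε ^ 2 / (V b - V a + 1), by positivity, fun ⟨n, I⟩ hI hlen => ?_⟩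
  have hmem := hI.1
  rw [uIcc_of_le hab] at hmem
  simp only at hlen hmem ⊢
  have hsum := h.monotoneOn.sum_abs_sub_le hab hI
  have hcs : (∑ i ∈ Finset.range n, dist (γ (I i).1) (γ (I i).2)) ^ 2 ≤
      (∑ i ∈ Finset.range n, dist (I i).1 (I i).2) *
        ∑ i ∈ Finset.range n, |V (I i).2 - V (I i).1| := by
    apply Finset.sum_sq_le_sum_mul_sum_of_sq_le_mul
    · intros; positivity
    · intros; positivity
    · intro i hi
      obtain ⟨h1, h2⟩ := hmem i hi
      refine (h _ h1 _ h2).trans ?_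
      rw [dist_comm, Real.dist_eq, ← abs_mul]
      exact le_abs_self _
  have hlt : (∑ i ∈ Finset.range n, dist (γ (I i).1) (γ (I i).2)) ^ 2 < ε ^ 2 := by
    refine hcs.trans_lt ?_
    have h1 : (∑ i ∈ Finset.range n, dist (I i).1 (I i).2) * (V b - V a + 1) < ε ^ 2 := by
      rwa [lt_div_iff₀ (by positivity)] at hlen
    refine lt_of_le_of_lt (mul_le_mul_of_nonneg_left ?_ ?_) h1
    · linarith
    · positivity
  exact lt_of_pow_lt_pow_left₀ 2 hε.le hlt

theorem metricSpeed_sq_le (h : IsArc γ V a b) {t : ℝ} (ht : t ∈ Ioo a b)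
    (hd : DifferentiableAt ℝ V t) : metricSpeed γ t ^ 2 ≤ ENNReal.ofReal (deriv V t) := by
  have hT : Tendsto (fun s => ENNReal.ofReal (Real.sqrt (slope V t s))) (𝓝[≠] t)
      (𝓝 (ENNReal.ofReal (Real.sqrt (deriv V t)))) :=
    ENNReal.tendsto_ofReal ((Real.continuous_sqrt.tendsto _).comp hd.hasDerivAt.tendsto_slope)
  have hle : metricSpeed γ t ≤ ENNReal.ofReal (Real.sqrt (deriv V t)) := by
    rw [← hT.limsup_eq]
    refine limsup_le_limsup ?_
    filter_upwards [self_mem_nhdsWithin, mem_nhdsWithin_of_mem_nhds (Icc_mem_nhds ht.1 ht.2)]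
      with s hs hs'
    have hne : s ≠ t := hs
    have hpos : 0 < dist s t := dist_pos.2 hne
    rw [edist_dist, edist_dist, ← ENNReal.ofReal_div_of_pos hpos]
    refine ENNReal.ofReal_le_ofReal (Real.le_sqrt_of_sq_le ?_)
    rw [div_pow, div_le_iff₀ (by positivity)]
    have h1 := h s hs' t (Ioo_subset_Icc_self ht)
    refine h1.trans (le_of_eq ?_)
    rw [slope_def_field, Real.dist_eq, sq_abs]
    have : s - t ≠ 0 := sub_ne_zero.2 hne
    field_simp
    ring
  calc metricSpeed γ t ^ 2 ≤ ENNReal.ofReal (Real.sqrt (deriv V t)) ^ 2 := by gcongr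
    _ = ENNReal.ofReal (deriv V t) := by
      have h0 : 0 ≤ deriv V t := by
        rw [← derivWithin_of_mem_nhds (Icc_mem_nhds ht.1 ht.2)]
        exact h.monotoneOn.derivWithin_nonneg
      rw [← ENNReal.ofReal_pow (Real.sqrt_nonneg _), Real.sq_sqrt h0]

/-- The squared speed is a.e. at most `V'`. As `V` is merely monotone, its derivative integrates to
at most the total increment, which is the direction needed. -/
theorem lintegral_metricSpeed_sq_le (h : IsArc γ V a b) (hab : a ≤ b) :
    ∫⁻ t in Icc a b, metricSpeed γ t ^ 2 ≤ ENNReal.ofReal (V b - V a) := by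
  have hm := h.monotoneOn
  rw [← uIcc_of_le hab] at hm
  have hint := hm.intervalIntegral_deriv_mem_uIcc
  have hVab : 0 ≤ V b - V a :=
    sub_nonneg.2 (h.monotoneOn (left_mem_Icc.2 hab) (right_mem_Icc.2 hab) hab)
  rw [uIcc_of_le hVab, intervalIntegral.integral_of_le hab, ← integral_Icc_eq_integral_Ioc] at hint
  have hii := (intervalIntegrable_iff_integrableOn_Icc_of_le hab).1 hm.intervalIntegrable_deriv
  have hnn : 0 ≤ᵐ[volume.restrict (Icc a b)] deriv V := by
    rw [← restrict_Ioo_eq_restrict_Icc, Filter.EventuallyLE, ae_restrict_iff' measurableSet_Ioo]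
    refine Eventually.of_forall fun t ht => ?_
    rw [← derivWithin_of_mem_nhds (Icc_mem_nhds ht.1 ht.2)]
    exact h.monotoneOn.derivWithin_nonneg
  calc ∫⁻ t in Icc a b, metricSpeed γ t ^ 2
      ≤ ∫⁻ t in Icc a b, ENNReal.ofReal (deriv V t) := by
        refine lintegral_mono_ae ?_
        rw [← restrict_Ioo_eq_restrict_Icc, ae_restrict_iff' measurableSet_Ioo]
        filter_upwards [h.monotoneOn.ae_differentiableWithinAt measurableSet_Icc |>
          (ae_restrict_iff' measurableSet_Icc).1] with t hdt ht
        exact h.metricSpeed_sq_le ht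
          ((hdt (Ioo_subset_Icc_self ht)).differentiableAt (Icc_mem_nhds ht.1 ht.2))
    _ = ENNReal.ofReal (∫ t in Icc a b, deriv V t) :=
        (ofReal_integral_eq_lintegral_ofReal hii hnn).symm
    _ ≤ _ := ENNReal.ofReal_le_ofReal hint.2

end IsArc

/-! ### Kinetic action and control functions. -/

section Action

variable {X : Type*} [MetricSpace X]

theorem enorm_deriv_dist_le_metricSpeed {γ : ℝ → X} {z : X} {t : ℝ}
    (hd : DifferentiableAt ℝ (fun r => dist (γ r) z) t) :
    ‖deriv (fun r => dist (γ r) z) t‖ₑ ≤ metricSpeed γ t := by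
  have hT := (continuous_enorm.tendsto _).comp hd.hasDerivAt.tendsto_slope
  rw [← hT.limsup_eq]
  refine limsup_le_limsup ?_
  filter_upwards [self_mem_nhdsWithin] with s hs
  have hne : s ≠ t := hs
  have hpos : 0 < dist s t := dist_pos.2 hne
  rw [edist_dist, edist_dist, ← ENNReal.ofReal_div_of_pos hpos, Function.comp_apply,
    Real.enorm_eq_ofReal_abs]
  refine ENNReal.ofReal_le_ofReal ?_
  rw [slope_def_field, abs_div, Real.dist_eq]
  gcongr
  exact abs_dist_sub_le _ _ _

theorem absolutelyContinuousOnInterval_dist {γ : ℝ → X} {a b : ℝ}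
    (h : AbsolutelyContinuousOnInterval γ a b) (z : X) :
    AbsolutelyContinuousOnInterval (fun r => dist (γ r) z) a b := by
  refine squeeze_zero (fun E => Finset.sum_nonneg fun i _ => dist_nonneg) (fun E => ?_) h
  refine Finset.sum_le_sum fun i _ => ?_
  rw [Real.dist_eq]
  exact abs_dist_sub_le _ _ _

theorem continuousOn_of_absolutelyContinuousOnInterval {γ : ℝ → X} {a b : ℝ}
    (h : AbsolutelyContinuousOnInterval γ a b) : ContinuousOn γ (uIcc a b) := by
  intro t ht
  have h1 := (absolutelyContinuousOnInterval_dist h (γ t)).continuousOn t ht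
  rw [ContinuousWithinAt, dist_self] at h1
  exact tendsto_iff_dist_tendsto_zero.2 h1

/-- The real function r ↦ d(γ_r, γ_s) is absolutely continuous with derivative at most the metric
speed, so the fundamental theorem of calculus and Cauchy–Schwarz apply to it. -/
theorem edist_sq_le_lintegral_metricSpeed {γ : ℝ → X} {a b s t : ℝ}
    (h : AbsolutelyContinuousOnInterval γ a b) (has : a ≤ s) (hst : s ≤ t) (htb : t ≤ b) :
    ENNReal.ofReal (dist (γ s) (γ t) ^ 2) ≤
      ENNReal.ofReal (t - s) * ∫⁻ r in Ioc s t, metricSpeed γ r ^ 2 := by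
  have hac : AbsolutelyContinuousOnInterval (fun r => dist (γ r) (γ s)) s t := by
    refine absolutelyContinuousOnInterval_dist (h.mono ?_) _
    rw [uIcc_of_le hst, uIcc_of_le (has.trans (hst.trans htb))]
    exact Icc_subset_Icc has htb
  set φ : ℝ → ℝ := fun r => dist (γ r) (γ s) with hφ
  have hftc := hac.integral_deriv_eq_sub
  have h1 : ENNReal.ofReal (dist (γ s) (γ t)) ≤ ∫⁻ r in Ioc s t, ‖deriv φ r‖ₑ := by
    have : dist (γ s) (γ t) = ∫ r in Ioc s t, deriv φ r := by
      rw [← intervalIntegral.integral_of_le hst, hftc]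
      simp [hφ, dist_comm]
    calc ENNReal.ofReal (dist (γ s) (γ t)) = ‖∫ r in Ioc s t, deriv φ r‖ₑ := by
          rw [← this, Real.enorm_eq_ofReal dist_nonneg]
      _ ≤ _ := enorm_integral_le_lintegral_enorm _
  -- Hölder is applied to `deriv φ`, whose measurability is automatic, and the metric speed enters
  -- only afterwards by comparison.
  have hmeas : AEMeasurable (fun r => ‖deriv φ r‖ₑ) (volume.restrict (Ioc s t)) :=
    (measurable_deriv φ).enorm.aemeasurable
  have hcs := ENNReal.lintegral_mul_le_Lp_mul_Lq (volume.restrict (Ioc s t))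
    Real.HolderConjugate.two_two hmeas (aemeasurable_const (b := (1 : ℝ≥0∞)))
  have h2 : (∫⁻ r in Ioc s t, ‖deriv φ r‖ₑ) ^ 2 ≤
      ENNReal.ofReal (t - s) * ∫⁻ r in Ioc s t, ‖deriv φ r‖ₑ ^ 2 := by
    simp only [Pi.mul_apply, mul_one, lintegral_const,
      Measure.restrict_apply MeasurableSet.univ, univ_inter, Real.volume_Ioc,
      ENNReal.rpow_two] at hcs
    calc _ ≤ _ := pow_le_pow_left' hcs 2
      _ = _ := by
        rw [mul_pow, ← ENNReal.rpow_two, ← ENNReal.rpow_two, ← ENNReal.rpow_mul,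
          ← ENNReal.rpow_mul]
        norm_num
        rw [mul_comm]
  have h3 : ∫⁻ r in Ioc s t, ‖deriv φ r‖ₑ ^ 2 ≤ ∫⁻ r in Ioc s t, metricSpeed γ r ^ 2 := by
    refine lintegral_mono_ae ?_
    rw [ae_restrict_iff' measurableSet_Ioc]
    filter_upwards [hac.ae_differentiableAt] with r hr hr'
    rw [uIcc_of_le hst] at hr
    gcongr
    exact enorm_deriv_dist_le_metricSpeed (hr (Ioc_subset_Icc_self hr'))
  rw [ENNReal.ofReal_pow dist_nonneg]
  calc _ ≤ _ := pow_le_pow_left' h1 2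
    _ ≤ _ := h2
    _ ≤ _ := by gcongr

theorem exists_isArc_of_lintegral_ne_top {γ : ℝ → X}
    (h : AbsolutelyContinuousOnInterval γ 0 1)
    (hfin : ∫⁻ t in Icc (0 : ℝ) 1, metricSpeed γ t ^ 2 ≠ ⊤) :
    ∃ V : ℝ → ℝ, IsArc γ V 0 1 ∧ Continuous V ∧
      V 1 - V 0 = (∫⁻ t in Icc (0 : ℝ) 1, metricSpeed γ t ^ 2).toReal := by
  set m : ℝ → ℝ≥0∞ := fun t => metricSpeed γ t ^ 2 with hm
  set μ : Measure ℝ := volume.restrict (Icc (0 : ℝ) 1) with hμ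
  -- The control function is the primitive of the squared speed. Restricting the measure to `[0,1]`
  -- makes it finite and continuous on all of `ℝ`.
  set F : ℝ → ℝ≥0∞ := fun t => ∫⁻ r in Iic t, m r ∂μ with hF
  have hFtop : ∀ t, F t ≠ ⊤ := fun t =>
    ne_top_of_le_ne_top hfin (lintegral_mono' Measure.restrict_le_self le_rfl)
  have hadd : ∀ s t, s ≤ t → F t = F s + ∫⁻ r in Ioc s t, m r ∂μ := by
    intro s t hst
    rw [hF]
    simp only
    rw [← Iic_union_Ioc_eq_Iic hst, lintegral_union measurableSet_Ioc]
    exact Set.disjoint_left.2 fun r h1 h2 => (not_lt.2 h1) h2.1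
  have hIoc : ∀ s t, 0 ≤ s → t ≤ 1 → ∫⁻ r in Ioc s t, m r ∂μ = ∫⁻ r in Ioc s t, m r := by
    intro s t hs ht
    rw [hμ, Measure.restrict_restrict measurableSet_Ioc, inter_eq_left.2]
    exact fun r hr => ⟨hs.trans hr.1.le, hr.2.trans ht⟩
  have hsub : ∀ s t, s ≤ t → (F t).toReal - (F s).toReal = (∫⁻ r in Ioc s t, m r ∂μ).toReal := by
    intro s t hst
    have h1 := hadd s t hst
    have h2 : ∫⁻ r in Ioc s t, m r ∂μ ≠ ⊤ := fun h => hFtop t (by rw [h1, h]; simp)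
    rw [h1, ENNReal.toReal_add (hFtop s) h2]
    ring
  have key : ∀ s t, 0 ≤ s → s ≤ t → t ≤ 1 →
      dist (γ s) (γ t) ^ 2 ≤ (t - s) * ((F t).toReal - (F s).toReal) := by
    intro s t hs hst ht
    have h1 := edist_sq_le_lintegral_metricSpeed h hs hst ht
    rw [hsub s t hst, hIoc s t hs ht]
    have h2 : ∫⁻ r in Ioc s t, m r ≠ ⊤ := by
      rw [← hIoc s t hs ht]
      intro h; exact hFtop t (by rw [hadd s t hst, h]; simp)
    have h3 := ENNReal.toReal_mono (ENNReal.mul_ne_top ENNReal.ofReal_ne_top h2) h1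
    rwa [ENNReal.toReal_mul, ENNReal.toReal_ofReal (sq_nonneg _),
      ENNReal.toReal_ofReal (sub_nonneg.2 hst)] at h3
  refine ⟨fun t => (F t).toReal, ?_, ?_, ?_⟩
  · intro s hs t ht
    rcases le_total s t with hst | hst
    · exact key s t hs.1 hst ht.2
    · have := key t s ht.1 hst hs.2
      rw [dist_comm]
      linarith
  · have hbound : ∀ s t, dist (F s).toReal (F t).toReal ≤
        (∫⁻ r in uIoc s t, m r ∂μ).toReal := by
      intro s t
      rcases le_total s t with hst | hst
      · rw [uIoc_of_le hst, ← hsub s t hst, dist_comm, Real.dist_eq, abs_of_nonneg]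
        rw [hsub s t hst]; positivity
      · rw [uIoc_of_ge hst, ← hsub t s hst, Real.dist_eq, abs_of_nonneg]
        rw [hsub t s hst]; positivity
    rw [continuous_iff_continuousAt]
    intro t
    rw [ContinuousAt, tendsto_iff_dist_tendsto_zero]
    refine squeeze_zero (fun _ => dist_nonneg) (fun s => hbound s t) ?_
    have h0 : Tendsto (fun s => ∫⁻ r in uIoc s t, m r ∂μ) (𝓝 t) (𝓝 0) := by
      refine tendsto_setLIntegral_zero hfin ?_
      refine tendsto_of_tendsto_of_tendsto_of_le_of_le (g := fun _ => 0)
        (h := fun s => ENNReal.ofReal |t - s|) tendsto_const_nhds ?_ (fun _ => zero_le) ?_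
      · have : Tendsto (fun s => |t - s|) (𝓝 t) (𝓝 |t - t|) := Continuous.tendsto (by fun_prop) t
        simpa using ENNReal.tendsto_ofReal this
      · intro s
        refine (Measure.restrict_apply_le _ _).trans ?_
        rw [Real.volume_uIoc]
    exact (ENNReal.tendsto_toReal ENNReal.zero_ne_top).comp h0
  · rw [hsub 0 1 zero_le_one, hIoc 0 1 le_rfl le_rfl, restrict_Ioc_eq_restrict_Icc]

/-- Together with `kineticAction_le_of_isArc`, this makes a finite action the least value of `(V 1 -
V 0) / 2` over control functions `V`. -/
theorem exists_isArc_of_kineticAction_ne_top {γ : Curve X} (h : kineticAction γ ≠ ⊤) :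
    ∃ V : ℝ → ℝ, IsArc γ.ext V 0 1 ∧ Continuous V ∧
      V 1 - V 0 = 2 * (kineticAction γ).toReal := by
  unfold kineticAction at h ⊢
  split_ifs at h ⊢ with hac
  · have hfin : ∫⁻ t in Icc (0 : ℝ) 1, metricSpeed γ.ext t ^ 2 ≠ ⊤ := fun hc => by
      simp [hc] at h
    obtain ⟨V, h1, h2, h3⟩ := exists_isArc_of_lintegral_ne_top hac hfin
    refine ⟨V, h1, h2, ?_⟩
    rw [h3, ENNReal.toReal_mul]
    simp
  · exact absurd rfl h

theorem kineticAction_le_of_isArc {γ : Curve X} {V : ℝ → ℝ} (h : IsArc γ.ext V 0 1) :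
    kineticAction γ ≤ ENNReal.ofReal ((V 1 - V 0) / 2) := by
  unfold kineticAction
  rw [if_pos (h.absolutelyContinuousOnInterval zero_le_one), ENNReal.ofReal_div_of_pos two_pos,
    ENNReal.div_eq_inv_mul]
  gcongr
  · simp
  · exact h.lintegral_metricSpeed_sq_le zero_le_one

end Action

/-! ### Reparametrization and concatenation of arcs. -/

namespace IsArc

variable {X : Type*} [MetricSpace X] {γ : ℝ → X} {V : ℝ → ℝ} {a b : ℝ}

theorem congr {γ' : ℝ → X} {V' : ℝ → ℝ} (h : IsArc γ V a b) (hγ : EqOn γ' γ (Icc a b))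
    (hV : EqOn V' V (Icc a b)) : IsArc γ' V' a b := by
  intro s hs t ht
  rw [hγ hs, hγ ht, hV hs, hV ht]
  exact h s hs t ht

/-- A factor `c` moves from the time increment to the increment of `V`. Its sign is free, so `c =
-1` reverses time. -/
theorem comp_affine {a' b' c e : ℝ} (h : IsArc γ V a b)
    (hm : MapsTo (fun t => c * t + e) (Icc a' b') (Icc a b)) :
    IsArc (fun t => γ (c * t + e)) (fun t => c * V (c * t + e)) a' b' := by
  intro s hs t ht
  refine (h _ (hm hs) _ (hm ht)).trans (le_of_eq ?_)
  ring

theorem union {m : ℝ} (h₁ : IsArc γ V a m) (h₂ : IsArc γ V m b) (ham : a ≤ m) (hmb : m ≤ b) :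
    IsArc γ V a b := by
  have cross : ∀ s ∈ Icc a m, ∀ t ∈ Icc m b,
      dist (γ s) (γ t) ^ 2 ≤ (t - s) * (V t - V s) := by
    intro s hs t ht
    have e1 := h₁ s hs m (right_mem_Icc.2 ham)
    have e2 := h₂ m (left_mem_Icc.2 hmb) t ht
    have v1 := h₁.monotoneOn hs (right_mem_Icc.2 ham) hs.2
    have v2 := h₂.monotoneOn (left_mem_Icc.2 hmb) ht ht.1
    have p1 : 0 ≤ m - s := sub_nonneg.2 hs.2
    have p2 : 0 ≤ t - m := sub_nonneg.2 ht.1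
    have w1 : 0 ≤ V m - V s := sub_nonneg.2 v1
    have w2 : 0 ≤ V t - V m := sub_nonneg.2 v2
    have d1 : 0 ≤ dist (γ s) (γ m) := dist_nonneg
    have d2 : 0 ≤ dist (γ m) (γ t) := dist_nonneg
    have htri := dist_triangle (γ s) (γ m) (γ t)
    generalize dist (γ s) (γ m) = x at *
    generalize dist (γ m) (γ t) = y at *
    -- After squaring, this is the arithmetic–geometric mean inequality for the two products on the
    -- right; it supplies the cross term of (x + y)².
    have hxy : 2 * (x * y) ≤ (m - s) * (V t - V m) + (t - m) * (V m - V s) := by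
      refine (sq_le_sq₀ (by positivity) (by positivity)).1 ?_
      have := mul_le_mul e1 e2 (sq_nonneg _) (by positivity)
      nlinarith [sq_nonneg ((m - s) * (V t - V m) - (t - m) * (V m - V s))]
    calc dist (γ s) (γ t) ^ 2 ≤ (x + y) ^ 2 := by gcongr
      _ ≤ (t - s) * (V t - V s) := by nlinarith
  intro s hs t ht
  rcases le_total s m with hsm | hsm <;> rcases le_total t m with htm | htm
  · exact h₁ s ⟨hs.1, hsm⟩ t ⟨ht.1, htm⟩
  · exact cross s ⟨hs.1, hsm⟩ t ⟨htm, ht.2⟩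
  · have := cross t ⟨ht.1, htm⟩ s ⟨hsm, hs.2⟩
    rw [dist_comm]
    linarith
  · exact h₂ s ⟨hsm, hs.2⟩ t ⟨htm, ht.2⟩

end IsArc

theorem setLIntegral_comp_affine_ne_top {f : ℝ → ℝ≥0∞} {a b a' b' c e : ℝ} (hc : c ≠ 0)
    (hm : MapsTo (fun t => c * t + e) (Icc a' b') (Icc a b))
    (hf : ∫⁻ t in Icc a b, f t ≠ ⊤) : ∫⁻ t in Icc a' b', f (c * t + e) ≠ ⊤ := by
  have hderiv : ∀ t ∈ Icc a' b', HasDerivWithinAt (fun t => c * t + e) c (Icc a' b') t := by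
    intro t _
    simpa using (((hasDerivAt_id t).const_mul c).add_const e).hasDerivWithinAt
  have hinj : InjOn (fun t => c * t + e) (Icc a' b') := by
    intro s _ t _ hst
    simpa [hc] using hst
  have h1 := lintegral_image_eq_lintegral_abs_deriv_mul measurableSet_Icc hderiv hinj f
  have h2 : ∫⁻ t in (fun t => c * t + e) '' Icc a' b', f t ≠ ⊤ :=
    ne_top_of_le_ne_top hf (lintegral_mono_set hm.image_subset)
  have hc' : ENNReal.ofReal |c| ≠ 0 := by simpa using hc
  rw [h1, lintegral_const_mul' _ _ ENNReal.ofReal_ne_top] at h2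
  intro h
  rw [h, ENNReal.mul_top hc'] at h2
  exact h2 rfl

/-! ### Points joined by arcs of bounded energy. -/

/-- The points `x` and `y` are joined by an arc on `[0, T]` whose squared speed has integral at
most `A` and along which `g` has finite integral. -/
def ArcJoined {X : Type*} [MetricSpace X] (g : X → ℝ≥0∞) (x y : X) (T A : ℝ) : Prop :=
  0 ≤ T ∧ ∃ (γ : ℝ → X) (V : ℝ → ℝ), IsArc γ V 0 T ∧ γ 0 = x ∧ γ T = y ∧ V T - V 0 ≤ A ∧
    ∫⁻ t in Icc 0 T, g (γ t) ≠ ⊤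

section Joined

variable {X : Type*} [MetricSpace X] {g : X → ℝ≥0∞} {x y z : X} {T T' A A' : ℝ}

theorem IsArc.arcJoined {γ : ℝ → X} {V : ℝ → ℝ} {a b : ℝ} (h : IsArc γ V a b) (hab : a ≤ b)
    (hg : ∫⁻ t in Icc a b, g (γ t) ≠ ⊤) : ArcJoined g (γ a) (γ b) (b - a) (V b - V a) := by
  have hm : MapsTo (fun t => 1 * t + a) (Icc 0 (b - a)) (Icc a b) := fun t ht =>
    ⟨by linarith [ht.1], by linarith [ht.2]⟩
  exact ⟨sub_nonneg.2 hab, _, _, h.comp_affine hm, by simp, by simp, by simp,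
    setLIntegral_comp_affine_ne_top (f := fun t => g (γ t)) one_ne_zero hm hg⟩

namespace ArcJoined

theorem mono (h : ArcJoined g x y T A) (hA : A ≤ A') : ArcJoined g x y T A' := by
  obtain ⟨hT, γ, V, h1, h2, h3, h4, h5⟩ := h
  exact ⟨hT, γ, V, h1, h2, h3, h4.trans hA, h5⟩

theorem forget (h : ArcJoined g x y T A) : ArcJoined 0 x y T A := by
  obtain ⟨hT, γ, V, h1, h2, h3, h4, _⟩ := h
  exact ⟨hT, γ, V, h1, h2, h3, h4, by simp⟩

theorem symm (h : ArcJoined g x y T A) : ArcJoined g y x T A := by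
  obtain ⟨hT, γ, V, h1, h2, h3, h4, h5⟩ := h
  have hm : MapsTo (fun t => -1 * t + T) (Icc 0 T) (Icc 0 T) := fun t ht =>
    ⟨by linarith [ht.2], by linarith [ht.1]⟩
  refine ⟨hT, _, _, h1.comp_affine hm, by simpa, by simpa, ?_,
    setLIntegral_comp_affine_ne_top (f := fun t => g (γ t)) (by norm_num) hm h5⟩
  simp only [mul_zero, zero_add]
  rw [show -1 * T + T = 0 by ring]
  linarith

theorem rescale (h : ArcJoined g x y T A) (hT : 0 < T) : ArcJoined g x y 1 (T * A) := by
  obtain ⟨-, γ, V, h1, h2, h3, h4, h5⟩ := h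
  have hm : MapsTo (fun t => T * t + 0) (Icc 0 1) (Icc 0 T) := fun t ht =>
    ⟨by nlinarith [ht.1], by nlinarith [ht.2]⟩
  refine ⟨zero_le_one, _, _, h1.comp_affine hm, by simpa, by simpa, ?_,
    setLIntegral_comp_affine_ne_top (f := fun t => g (γ t)) hT.ne' hm h5⟩
  simp only [mul_zero, mul_one, add_zero]
  nlinarith

theorem trans (h : ArcJoined g x y T A) (h' : ArcJoined g y z T' A') :
    ArcJoined g x z (T + T') (A + A') := by
  obtain ⟨hT, γ, V, h1, h2, h3, h4, h5⟩ := h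
  obtain ⟨hT', γ', V', h1', h2', h3', h4', h5'⟩ := h'
  let Γ : ℝ → X := fun t => if t ≤ T then γ t else γ' (1 * t + -T)
  -- The constant `V T - V' 0` makes the two control functions agree at the junction; `1 *` matches
  -- the form produced by `comp_affine`.
  let W : ℝ → ℝ := fun t => if t ≤ T then V t else 1 * V' (1 * t + -T) + (V T - V' 0)
  have hm : MapsTo (fun t => 1 * t + -T) (Icc T (T + T')) (Icc 0 T') := fun t ht =>
    ⟨by linarith [ht.1], by linarith [ht.2]⟩
  have e1 : EqOn Γ γ (Icc 0 T) := fun t ht => by simp [Γ, ht.2]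
  have e2 : EqOn Γ (fun t => γ' (1 * t + -T)) (Icc T (T + T')) := fun t ht => by
    rcases ht.1.eq_or_lt with rfl | hlt
    · simp [Γ, h3, h2']
    · simp [Γ, not_le.2 hlt]
  have f1 : EqOn W V (Icc 0 T) := fun t ht => by simp [W, ht.2]
  have f2 : EqOn W (fun t => 1 * V' (1 * t + -T) + (V T - V' 0)) (Icc T (T + T')) :=
    fun t ht => by
      rcases ht.1.eq_or_lt with rfl | hlt
      · simp [W]
      · simp [W, not_le.2 hlt]
  have a1 : IsArc Γ W 0 T := h1.congr e1 f1
  have a2 : IsArc Γ W T (T + T') := by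
    refine IsArc.congr (fun s hs t ht => ?_) e2 f2
    simpa using h1'.comp_affine hm s hs t ht
  have m0 : (0 : ℝ) ∈ Icc 0 T := left_mem_Icc.2 hT
  have m1 : T + T' ∈ Icc T (T + T') := right_mem_Icc.2 (by linarith)
  refine ⟨by positivity, Γ, W, a1.union a2 hT (by linarith), by rw [e1 m0, h2],
    by rw [e2 m1]; simpa, ?_, ?_⟩
  · rw [f1 m0, f2 m1]
    simp only [one_mul]
    rw [show T + T' + -T = T' by ring]
    linarith
  · have hsub : Icc 0 (T + T') ⊆ Icc 0 T ∪ Icc T (T + T') := by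
      intro t ht
      rcases le_total t T with h | h
      · exact Or.inl ⟨ht.1, h⟩
      · exact Or.inr ⟨h, ht.2⟩
    refine ne_top_of_le_ne_top ?_ ((lintegral_mono_set hsub).trans (lintegral_union_le _ _ _))
    refine ENNReal.add_ne_top.2 ⟨?_, ?_⟩
    · rw [setLIntegral_congr_fun measurableSet_Icc (fun t ht => by rw [e1 ht])]
      exact h5
    · rw [setLIntegral_congr_fun measurableSet_Icc (fun t ht => by rw [e2 ht])]
      exact setLIntegral_comp_affine_ne_top (f := fun t => g (γ' t)) one_ne_zero hm h5'

/-- The image of an arc under a Lipschitz map which makes `g` bounded on bounded sets. -/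
theorem map (h : ArcJoined 0 x y T A) {F : X → X} {K : ℝ}
    (hF : ∀ p q, dist (F p) (F q) ≤ K * dist p q)
    (hg : ∀ B : Set X, Bornology.IsBounded B → ∃ M : ℝ≥0∞, M ≠ ⊤ ∧ ∀ p ∈ B, g (F p) ≤ M) :
    ArcJoined g (F x) (F y) T (K ^ 2 * A) := by
  obtain ⟨hT, γ, V, h1, rfl, rfl, h4, -⟩ := h
  refine ⟨hT, fun t => F (γ t), fun t => K ^ 2 * V t, ?_, rfl, rfl, ?_, ?_⟩
  · intro s hs t ht
    calc dist (F (γ s)) (F (γ t)) ^ 2 ≤ (K * dist (γ s) (γ t)) ^ 2 := by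
          gcongr; exact hF _ _
      _ = K ^ 2 * dist (γ s) (γ t) ^ 2 := by ring
      _ ≤ K ^ 2 * ((t - s) * (V t - V s)) := by gcongr; exact h1 s hs t ht
      _ = _ := by ring
  · rw [← mul_sub]
    exact mul_le_mul_of_nonneg_left h4 (sq_nonneg K)
  · have hcont := continuousOn_of_absolutelyContinuousOnInterval
      (h1.absolutelyContinuousOnInterval hT)
    rw [uIcc_of_le hT] at hcont
    obtain ⟨M, hM, hle⟩ := hg _ (isCompact_Icc.image_of_continuousOn hcont).isBounded
    have hint : ∫⁻ t in Icc 0 T, g (F (γ t)) ≤ ∫⁻ _ in Icc 0 T, M :=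
      setLIntegral_mono measurable_const fun t ht => hle _ (mem_image_of_mem γ ht)
    refine ne_top_of_le_ne_top ?_ hint
    rw [setLIntegral_const, Real.volume_Icc]
    exact ENNReal.mul_ne_top hM ENNReal.ofReal_ne_top

theorem exists_curve {E : X → EReal} (h : ArcJoined (fun p => metricSlope E p ^ 2) x y 1 A) :
    ∃ γ : Curve X, γ.Joins x y ∧ kineticAction γ ≤ ENNReal.ofReal (A / 2) ∧
      fisherInformation E γ ≠ ⊤ := by
  obtain ⟨-, γ, V, h1, rfl, rfl, h4, h5⟩ := h
  have hcont := continuousOn_of_absolutelyContinuousOnInterval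
    (h1.absolutelyContinuousOnInterval zero_le_one)
  rw [uIcc_of_le zero_le_one] at hcont
  let ω : Curve X := ⟨fun t => γ t, continuousOn_iff_continuous_domRestrict.1 hcont⟩
  have hω : EqOn ω.ext γ (Icc 0 1) := fun t ht => by
    simp only [Curve.ext]
    rw [IccExtend_of_mem _ _ ht]
    rfl
  refine ⟨ω, ⟨rfl, rfl⟩, ?_, ?_⟩
  · refine (kineticAction_le_of_isArc (h1.congr hω fun _ _ => rfl)).trans ?_
    exact ENNReal.ofReal_le_ofReal (by linarith)
  · unfold fisherInformation
    rw [setLIntegral_congr_fun measurableSet_Icc (fun t ht => by rw [hω ht])]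
    exact ENNReal.mul_ne_top (by simp) h5

end ArcJoined

end Joined

/-! ### Calculus for the evolution variational inequality. -/

theorem AbsolutelyContinuousOnInterval.le_of_ae_deriv_nonpos {φ : ℝ → ℝ} {a b : ℝ} (hab : a ≤ b)
    (h : AbsolutelyContinuousOnInterval φ a b)
    (hd : ∀ᵐ t, t ∈ Ioo a b → deriv φ t ≤ 0) : φ b ≤ φ a := by
  have h1 := h.integral_deriv_eq_sub
  rw [intervalIntegral.integral_of_le hab, ← restrict_Ioo_eq_restrict_Ioc] at h1
  have h2 : ∫ t in Ioo a b, deriv φ t ≤ 0 :=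
    integral_nonpos_of_ae ((ae_restrict_iff' measurableSet_Ioo).2 hd)
  linarith

theorem AbsolutelyContinuousOnInterval.comp_add_const {X : Type*} [MetricSpace X] {γ : ℝ → X}
    {a b c : ℝ} (h : AbsolutelyContinuousOnInterval γ (a + c) (b + c)) :
    AbsolutelyContinuousOnInterval (fun t => γ (t + c)) a b := by
  rw [absolutelyContinuousOnInterval_iff] at h ⊢
  intro ε hε
  obtain ⟨δ, hδ, H⟩ := h ε hε
  refine ⟨δ, hδ, fun ⟨n, I⟩ hI hlen => ?_⟩
  refine H (n, fun i => ((I i).1 + c, (I i).2 + c)) ⟨fun i hi => ?_, ?_⟩ (by simpa using hlen)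
  · have := hI.1 i hi
    simp only [← image_add_const_uIcc]
    exact ⟨mem_image_of_mem _ this.1, mem_image_of_mem _ this.2⟩
  · intro i hi j hj hij
    have hd : Disjoint (uIoc _ _) (uIoc _ _) := hI.2 hi hj hij
    refine Set.disjoint_left.2 fun p hp hq => Set.disjoint_left.1 hd (?_ : p - c ∈ _) ?_
    · simp only [mem_uIoc] at hp ⊢
      rcases hp with hp | hp
      · exact Or.inl ⟨by linarith [hp.1], by linarith [hp.2]⟩
      · exact Or.inr ⟨by linarith [hp.1], by linarith [hp.2]⟩
    · simp only [mem_uIoc] at hq ⊢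
      rcases hq with hp | hp
      · exact Or.inl ⟨by linarith [hp.1], by linarith [hp.2]⟩
      · exact Or.inr ⟨by linarith [hp.1], by linarith [hp.2]⟩

/-- The primitive `∫₀ᵗ e^{lam r} dr`. -/
noncomputable def expPrimitive (lam t : ℝ) : ℝ := ∫ r in (0 : ℝ)..t, Real.exp (lam * r)

theorem expPrimitive_zero (lam : ℝ) : expPrimitive lam 0 = 0 := by simp [expPrimitive]

theorem hasDerivAt_expPrimitive (lam t : ℝ) :
    HasDerivAt (expPrimitive lam) (Real.exp (lam * t)) t := by
  have hc : Continuous fun r : ℝ => Real.exp (lam * r) := by fun_prop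
  exact intervalIntegral.integral_hasDerivAt_right (hc.intervalIntegrable _ _)
    hc.aestronglyMeasurable.stronglyMeasurableAtFilter hc.continuousAt

theorem continuous_expPrimitive (lam : ℝ) : Continuous (expPrimitive lam) :=
  continuous_iff_continuousAt.2 fun t => (hasDerivAt_expPrimitive lam t).continuousAt

theorem expPrimitive_pos (lam : ℝ) {t : ℝ} (ht : 0 < t) : 0 < expPrimitive lam t :=
  intervalIntegral.intervalIntegral_pos_of_pos
    (Continuous.intervalIntegrable (by fun_prop) _ _) (fun _ => Real.exp_pos _) ht

theorem expPrimitive_le {lam t : ℝ} (ht : 0 ≤ t) (ht1 : t ≤ 1) :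
    expPrimitive lam t ≤ Real.exp |lam| * t := by
  have := intervalIntegral.norm_integral_le_of_norm_le_const (a := 0) (b := t)
    (f := fun r => Real.exp (lam * r)) (C := Real.exp |lam|) (by
      intro r hr
      rw [uIoc_of_le ht] at hr
      rw [Real.norm_eq_abs, Real.abs_exp]
      refine Real.exp_le_exp.2 ((le_abs_self _).trans ?_)
      rw [abs_mul, abs_of_pos hr.1]
      exact mul_le_of_le_one_right (abs_nonneg _) (hr.2.trans ht1))
  rw [sub_zero, abs_of_nonneg ht] at this
  exact (le_abs_self _).trans this

theorem tendsto_expPrimitive_div (lam : ℝ) :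
    Tendsto (fun h => expPrimitive lam h / h) (𝓝[>] 0) (𝓝 1) := by
  have := (hasDerivAt_expPrimitive lam 0).tendsto_slope.mono_left
    (nhdsWithin_mono 0 (fun t ht => ne_of_gt (mem_Ioi.1 ht)))
  simpa [slope_fun_def_field, expPrimitive_zero] using this

/-! ### Energy decay and contraction along the flow. -/

namespace IsEVIFlow

variable {X : Type*} [MetricSpace X] {E : X → EReal} {lam : ℝ} {u v : ℝ → X} {x y : X}

theorem continuousAt (hu : IsEVIFlow E lam u x) {t : ℝ} (ht : 0 < t) : ContinuousAt u t := by
  have h := continuousOn_of_absolutelyContinuousOnInterval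
    (hu.locally_ac (t / 2) (t + 1) (by linarith) (by linarith))
  rw [uIcc_of_le (by linarith)] at h
  exact h.continuousAt (Icc_mem_nhds (by linarith) (by linarith))

theorem shift (hu : IsEVIFlow E lam u x) {a : ℝ} (ha : 0 < a) :
    IsEVIFlow E lam (fun t => u (t + a)) (u a) where
  locally_ac s t hs hst :=
    (hu.locally_ac (s + a) (t + a) (by linarith) (by linarith)).comp_add_const
  evi z := by
    have h1 := (ae_restrict_iff' measurableSet_Ioi).1 (hu.evi z)
    have h2 := (measurePreserving_add_right volume a).quasiMeasurePreserving.ae h1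
    rw [ae_restrict_iff' measurableSet_Ioi]
    filter_upwards [h2] with t ht ht0
    have := ht (mem_Ioi.2 (by linarith [mem_Ioi.1 ht0]))
    rwa [← deriv_comp_add_const] at this
  starts := by
    have h1 : Tendsto (fun t : ℝ => t + a) (𝓝 0) (𝓝 a) := by
      simpa using (continuous_add_const a).tendsto (0 : ℝ)
    exact ((hu.continuousAt ha).tendsto.comp h1).mono_left nhdsWithin_le_nhds

/-- Integrated form of the evolution variational inequality. -/
theorem sub_le_of_forall (hu : IsEVIFlow E lam u x) {z : X} {s t c : ℝ} (hs : 0 < s) (hst : s ≤ t)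
    (hc : ∀ r ∈ Ioo s t, ∀ p : ℝ, (p : EReal) + E (u r) ≤ E z → p ≤ c) :
    Real.exp (lam * t) * dist (u t) z ^ 2 - Real.exp (lam * s) * dist (u s) z ^ 2 ≤
      2 * c * (expPrimitive lam t - expPrimitive lam s) := by
  have hd := absolutelyContinuousOnInterval_dist (hu.locally_ac s t hs hst) z
  have hd2 : AbsolutelyContinuousOnInterval (fun r => dist (u r) z ^ 2) s t := by
    simpa [sq] using hd.fun_mul hd
  have hexp : AbsolutelyContinuousOnInterval (fun r => Real.exp (lam * r)) s t :=
    ContDiffOn.absolutelyContinuousOnInterval (ContDiff.contDiffOn (by fun_prop))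
  have hG : AbsolutelyContinuousOnInterval (expPrimitive lam) s t := by
    refine ContDiffOn.absolutelyContinuousOnInterval (ContDiff.contDiffOn ?_)
    rw [contDiff_one_iff_deriv]
    refine ⟨fun r => (hasDerivAt_expPrimitive lam r).differentiableAt, ?_⟩
    rw [funext fun r => (hasDerivAt_expPrimitive lam r).deriv]
    fun_prop
  -- Multiplying the EVI by 2e^{λr} makes its left-hand distance terms the derivative of e^{λr}
  -- d²(u_r, z), so subtracting 2c times the primitive of e^{λr} gives a nonincreasing function.
  have hΦ := (hexp.fun_mul hd2).fun_sub (hG.const_mul (2 * c))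
  have key := hΦ.le_of_ae_deriv_nonpos hst (by
    have hevi := (ae_restrict_iff' measurableSet_Ioi).1 (hu.evi z)
    filter_upwards [hevi, hd2.ae_differentiableAt] with r hr hdr hrst
    rw [uIcc_of_le hst] at hdr
    -- The energies enter only through this real bound, so no subtraction of possibly infinite
    -- values occurs.
    have hp := hc r hrst _ (hr (mem_Ioi.2 (hs.trans hrst.1)))
    have hD := (hdr (Ioo_subset_Icc_self hrst)).hasDerivAt
    have he : HasDerivAt (fun r => Real.exp (lam * r)) (Real.exp (lam * r) * lam) r := by
      simpa using ((hasDerivAt_id r).const_mul lam).exp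
    have hall := (he.fun_mul hD).fun_sub ((hasDerivAt_expPrimitive lam r).const_mul (2 * c))
    rw [hall.deriv]
    have hpos := Real.exp_pos (lam * r)
    nlinarith)
  linarith

/-- Otherwise let `m` be the last time in `[s, t]` with energy at most `E (u s)`; it exists by lower
semicontinuity. Afterwards the energy exceeds `E (u m)`, so the EVI tested with `u m` forbids
leaving that point, and `u t = u m`. -/
theorem energy_antitone (hE : IsEVIFunctional E) (hu : IsEVIFlow E lam u x) {s t : ℝ} (hs : 0 < s)
    (hst : s ≤ t) : E (u t) ≤ E (u s) := by
  by_contra! hlt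
  have hcont : ContinuousOn u (Icc s t) := fun r hr =>
    (hu.continuousAt (hs.trans_le hr.1)).continuousWithinAt
  have hcl : IsClosed (Icc s t ∩ u ⁻¹' {p | E p ≤ E (u s)}) :=
    hcont.preimage_isClosed_of_isClosed isClosed_Icc (hE.lsc.isClosed_preimage _)
  obtain ⟨m, ⟨hm1, hm2⟩, hm3⟩ :=
    (isCompact_Icc.of_isClosed_subset hcl inter_subset_left).exists_isGreatest
    ⟨s, left_mem_Icc.2 hst, le_refl (E (u s))⟩
  have hm0 : 0 < m := hs.trans_le hm1.1
  have hm2 : E (u m) ≤ E (u s) := hm2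
  have key := hu.sub_le_of_forall (z := u m) (c := 0) hm0 hm1.2 (by
    intro r hr p hp
    have hr' : E (u s) < E (u r) := by
      by_contra! hc
      exact absurd (hm3 ⟨⟨hm1.1.trans hr.1.le, hr.2.le⟩, hc⟩) (not_le.2 hr.1)
    by_contra! hp0
    have h1 : E (u r) ≤ p + E (u r) := by
      calc E (u r) = 0 + E (u r) := (zero_add _).symm
        _ ≤ _ := by gcongr; exact_mod_cast hp0.le
    exact absurd (h1.trans (hp.trans hm2)) (not_le.2 hr'))
  rw [dist_self] at key
  have h0 : dist (u t) (u m) ^ 2 ≤ 0 := by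
    have := Real.exp_pos (lam * t)
    by_contra! hc
    nlinarith
  have h1 : u t = u m := dist_eq_zero.1
    (pow_eq_zero_iff two_ne_zero |>.1 (le_antisymm h0 (sq_nonneg _)))
  rw [h1] at hlt
  exact absurd hm2 (not_le.2 hlt)

/-- Testing with a point of the domain gives finite energy at a.e. time, and monotonicity extends
this to every positive time. -/
theorem energy_ne_top (hE : IsEVIFunctional E) (hu : IsEVIFlow E lam u x) {t : ℝ} (ht : 0 < t) :
    E (u t) ≠ ⊤ := by
  have : Nonempty X := ⟨x⟩
  obtain ⟨z, hz⟩ := hE.dense_domain.nonempty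
  have hae : ∀ᵐ r ∂(volume.restrict (Ioo 0 t)), E (u r) ≠ ⊤ := by
    have h1 := ae_restrict_of_ae_restrict_of_subset (s := Ioo 0 t) (fun r hr => mem_Ioi.2 hr.1)
      (hu.evi z)
    filter_upwards [h1] with r hr htop
    rw [htop, EReal.coe_add_top] at hr
    exact hz (top_le_iff.1 hr)
  have hne : (ae (volume.restrict (Ioo (0 : ℝ) t))).NeBot := by
    rw [ae_neBot]
    intro h0
    rw [Measure.restrict_eq_zero, Real.volume_Ioo] at h0
    simp at h0
    linarith
  obtain ⟨r, hr, hr'⟩ := (hae.and (ae_restrict_mem measurableSet_Ioo)).exists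
  exact ne_top_of_le_ne_top hr (hu.energy_antitone hE hr'.1 hr'.2.le)

end IsEVIFlow

theorem IsEVIFunctional.coe_toReal {X : Type*} [MetricSpace X] {E : X → EReal}
    (hE : IsEVIFunctional E) {x : X} (hx : E x ≠ ⊤) : ((E x).toReal : EReal) = E x :=
  EReal.coe_toReal hx (hE.ne_bot x)

namespace IsEVIFlow

variable {X : Type*} [MetricSpace X] {E : X → EReal} {lam : ℝ} {u v : ℝ → X} {x y : X}

/-- As the energy decreases, c = E(z) - E(u_h) is admissible in the integrated EVI on `[s, h]`; then
s ↓ 0. The starting point may have infinite energy. -/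
theorem exp_mul_dist_sq_sub_le (hE : IsEVIFunctional E) (hu : IsEVIFlow E lam u x) {z : X}
    (hz : E z ≠ ⊤) {h : ℝ} (hh : 0 < h) :
    Real.exp (lam * h) * dist (u h) z ^ 2 - dist x z ^ 2 ≤
      2 * expPrimitive lam h * ((E z).toReal - (E (u h)).toReal) := by
  have hpos : ∀ᶠ s in 𝓝[>] (0 : ℝ), s ∈ Ioo 0 h := Ioo_mem_nhdsGT hh
  have hev : ∀ᶠ s in 𝓝[>] (0 : ℝ),
      Real.exp (lam * h) * dist (u h) z ^ 2 - Real.exp (lam * s) * dist (u s) z ^ 2 ≤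
      2 * ((E z).toReal - (E (u h)).toReal) * (expPrimitive lam h - expPrimitive lam s) := by
    filter_upwards [hpos] with s hs
    refine hu.sub_le_of_forall hs.1 hs.2.le fun r hr p hp => ?_
    have h1 : (p : EReal) + E (u h) ≤ E z :=
      le_trans (by gcongr; exact hu.energy_antitone hE (hs.1.trans hr.1) hr.2.le) hp
    rw [← hE.coe_toReal (hu.energy_ne_top hE hh), ← hE.coe_toReal hz] at h1
    have h2 : p + (E (u h)).toReal ≤ (E z).toReal := by exact_mod_cast h1
    linarith
  have t1 : Tendsto (fun s => Real.exp (lam * s)) (𝓝[>] (0 : ℝ)) (𝓝 1) := by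
    have : Continuous fun s : ℝ => Real.exp (lam * s) := by fun_prop
    simpa using (this.tendsto 0).mono_left nhdsWithin_le_nhds
  have t2 : Tendsto (fun s => dist (u s) z ^ 2) (𝓝[>] (0 : ℝ)) (𝓝 (dist x z ^ 2)) :=
    (hu.starts.dist tendsto_const_nhds).pow 2
  have t3 : Tendsto (expPrimitive lam) (𝓝[>] (0 : ℝ)) (𝓝 0) := by
    have := ((continuous_expPrimitive lam).tendsto 0).mono_left
      (nhdsWithin_le_nhds (s := Ioi (0 : ℝ)))
    rwa [expPrimitive_zero] at this
  have := le_of_tendsto_of_tendsto (tendsto_const_nhds.sub (t1.mul t2))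
    (tendsto_const_nhds.mul (tendsto_const_nhds.sub t3)) hev
  linarith

theorem energy_le_start (hE : IsEVIFunctional E) (hu : IsEVIFlow E lam u x) (hx : E x ≠ ⊤) {h : ℝ}
    (hh : 0 < h) : (E (u h)).toReal ≤ (E x).toReal := by
  have h1 := hu.exp_mul_dist_sq_sub_le hE hx hh
  have h2 := expPrimitive_pos lam hh
  rw [dist_self] at h1
  have h3 : 0 ≤ 2 * expPrimitive lam h * ((E x).toReal - (E (u h)).toReal) :=
    le_trans (by rw [zero_pow two_ne_zero, sub_zero]; positivity) h1
  have := nonneg_of_mul_nonneg_right h3 (by positivity)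
  linarith

theorem tendsto_energy (hE : IsEVIFunctional E) (hu : IsEVIFlow E lam u x) (hx : E x ≠ ⊤) :
    Tendsto (fun h => (E (u h)).toReal) (𝓝[>] 0) (𝓝 (E x).toReal) := by
  rw [tendsto_order]
  constructor
  · intro a ha
    have h1 : (a : EReal) < E x := by
      rw [← hE.coe_toReal hx]; exact_mod_cast ha
    filter_upwards [hu.starts.eventually (hE.lsc x a h1), self_mem_nhdsWithin] with h hh hpos
    rw [← hE.coe_toReal (hu.energy_ne_top hE hpos)] at hh
    exact_mod_cast hh
  · intro a ha
    filter_upwards [self_mem_nhdsWithin] with h hpos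
    exact (hu.energy_le_start hE hx hpos).trans_lt ha

theorem dist_sq_le (hE : IsEVIFunctional E) (hu : IsEVIFlow E lam u x) (hx : E x ≠ ⊤) {h : ℝ}
    (hh : 0 < h) (hh1 : h ≤ 1) :
    dist x (u h) ^ 2 ≤ 2 * Real.exp (2 * |lam|) * (h * ((E x).toReal - (E (u h)).toReal)) := by
  have h1 := hu.exp_mul_dist_sq_sub_le hE hx hh
  have h2 := expPrimitive_le (lam := lam) hh.le hh1
  have h3 := hu.energy_le_start hE hx hh
  rw [dist_self, dist_comm] at h1
  have h4 : Real.exp (-|lam|) ≤ Real.exp (lam * h) := by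
    refine Real.exp_le_exp.2 ?_
    have : |lam * h| ≤ |lam| := by
      rw [abs_mul, abs_of_pos hh]
      exact mul_le_of_le_one_right (abs_nonneg _) hh1
    linarith [neg_abs_le (lam * h)]
  have h5 : Real.exp (-|lam|) * dist x (u h) ^ 2 ≤
      2 * (Real.exp |lam| * h) * ((E x).toReal - (E (u h)).toReal) := by
    calc _ ≤ Real.exp (lam * h) * dist x (u h) ^ 2 := by gcongr
      _ ≤ 2 * expPrimitive lam h * ((E x).toReal - (E (u h)).toReal) := by linarith
      _ ≤ _ := by
        have : 0 ≤ (E x).toReal - (E (u h)).toReal := by linarith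
        gcongr
  calc dist x (u h) ^ 2 = Real.exp |lam| * (Real.exp (-|lam|) * dist x (u h) ^ 2) := by
        rw [← mul_assoc, ← Real.exp_add]; simp
    _ ≤ Real.exp |lam| * (2 * (Real.exp |lam| * h) * ((E x).toReal - (E (u h)).toReal)) := by
        gcongr
    _ = _ := by
      rw [two_mul |lam|, Real.exp_add]; ring

/-- Infinitesimal contraction: test `u` with `v h` and `v` with `x`, then add the estimates, the
first weighted by e^{λh}. The error divided by `h` tends to 0 because both energies converge to
their initial values. -/
theorem eventually_dist_sq_sub_lt (hE : IsEVIFunctional E) (hu : IsEVIFlow E lam u x)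
    (hv : IsEVIFlow E lam v y) (hx : E x ≠ ⊤) (hy : E y ≠ ⊤) {r : ℝ} (hr : 0 < r) :
    ∀ᶠ h in 𝓝[>] (0 : ℝ),
      (Real.exp (lam * h) ^ 2 * dist (u h) (v h) ^ 2 - dist x y ^ 2) / h < r := by
  have t1 : Tendsto (fun s => Real.exp (lam * s)) (𝓝[>] (0 : ℝ)) (𝓝 1) := by
    have : Continuous fun s : ℝ => Real.exp (lam * s) := by fun_prop
    simpa using (this.tendsto 0).mono_left nhdsWithin_le_nhds
  have t2 := hu.tendsto_energy hE hx
  have t3 := hv.tendsto_energy hE hy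
  have t4 := (((tendsto_expPrimitive_div lam).const_mul 2).mul
    (((t1.sub_const 1).mul (t3.sub t2)).add (tendsto_const_nhds (x := (E x).toReal) |>.sub t2)))
  simp only [sub_self, zero_mul, add_zero, mul_zero] at t4
  filter_upwards [t4.eventually (gt_mem_nhds hr), self_mem_nhdsWithin] with h hlt hpos
  have hpos : 0 < h := hpos
  refine lt_of_le_of_lt ?_ hlt
  have e1 := hu.exp_mul_dist_sq_sub_le hE (hv.energy_ne_top hE hpos) hpos
  have e2 := hv.exp_mul_dist_sq_sub_le hE hx hpos
  have hq := Real.exp_pos (lam * h)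
  rw [div_le_iff₀ hpos]
  have e3 := mul_le_mul_of_nonneg_left e1 hq.le
  rw [dist_comm (v h) x, dist_comm y x] at e2
  have e4 : 2 * (expPrimitive lam h / h) *
      ((Real.exp (lam * h) - 1) * ((E (v h)).toReal - (E (u h)).toReal) +
        ((E x).toReal - (E (u h)).toReal)) * h = 2 * expPrimitive lam h *
      ((Real.exp (lam * h) - 1) * ((E (v h)).toReal - (E (u h)).toReal) +
        ((E x).toReal - (E (u h)).toReal)) := by
    field_simp
  rw [e4]
  nlinarith

/-- Flows contract the distance at rate `e^{-lam t}`. -/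
theorem exp_mul_dist_le (hE : IsEVIFunctional E) (hu : IsEVIFlow E lam u x)
    (hv : IsEVIFlow E lam v y) {h : ℝ} (hh : 0 < h) :
    Real.exp (lam * h) * dist (u h) (v h) ≤ dist x y := by
  set R : ℝ → ℝ := fun t => Real.exp (lam * t) ^ 2 * dist (u t) (v t) ^ 2 with hR
  have hmono : ∀ a, 0 < a → a ≤ h → R h ≤ R a := by
    intro a ha hah
    -- `R` does not increase because its upper right derivative is at most 0. This follows at each t
    -- > 0 by restarting both flows there, where the energies are finite.
    have := image_le_of_liminf_slope_right_le_deriv_boundary (f := R) (a := a) (b := h)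
      (B := fun _ => R a) (B' := fun _ => 0) (fun t ht => ?_) le_rfl continuousOn_const
      (fun t _ => hasDerivWithinAt_const _ _ _) (fun t ht r hr => ?_)
    · exact this (right_mem_Icc.2 hah)
    · have ht0 : 0 < t := ha.trans_le ht.1
      have hexp : Continuous fun s : ℝ => Real.exp (lam * s) := by fun_prop
      exact ((hexp.continuousAt.pow 2).mul
        (((hu.continuousAt ht0).dist (hv.continuousAt ht0)).pow 2)).continuousWithinAt
    · have ht0 : 0 < t := ha.trans_le ht.1
      refine Eventually.frequently ?_
      have hc : 0 < Real.exp (lam * t) ^ 2 := by positivity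
      have hev := (hu.shift ht0).eventually_dist_sq_sub_lt hE (hv.shift ht0)
        (hu.energy_ne_top hE ht0) (hv.energy_ne_top hE ht0) (div_pos hr hc)
      have htend : Tendsto (fun z => z - t) (𝓝[>] t) (𝓝[>] 0) := by
        refine tendsto_nhdsWithin_iff.2 ⟨?_, ?_⟩
        · have : Tendsto (fun z => z - t) (𝓝 t) (𝓝 (t - t)) :=
            Continuous.tendsto (by fun_prop) t
          rw [sub_self] at this
          exact this.mono_left nhdsWithin_le_nhds
        · filter_upwards [self_mem_nhdsWithin] with z hz
          exact sub_pos.2 (mem_Ioi.1 hz)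
      filter_upwards [htend.eventually hev] with z hz
      rw [lt_div_iff₀ hc, sub_add_cancel] at hz
      rw [slope_def_field]
      refine lt_of_eq_of_lt ?_ hz
      have : Real.exp (lam * z) = Real.exp (lam * (z - t)) * Real.exp (lam * t) := by
        rw [← Real.exp_add]; congr 1; ring
      simp only [hR]
      rw [this]
      ring
  have hlim : Tendsto R (𝓝[>] 0) (𝓝 (dist x y ^ 2)) := by
    have t1 : Tendsto (fun s => Real.exp (lam * s)) (𝓝[>] (0 : ℝ)) (𝓝 1) := by
      have : Continuous fun s : ℝ => Real.exp (lam * s) := by fun_prop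
      simpa using (this.tendsto 0).mono_left nhdsWithin_le_nhds
    simpa using (t1.pow 2).mul ((hu.starts.dist hv.starts).pow 2)
  have hle : R h ≤ dist x y ^ 2 := by
    refine ge_of_tendsto hlim ?_
    filter_upwards [Ioo_mem_nhdsGT hh] with a ha
    exact hmono a ha.1 ha.2.le
  refine (sq_le_sq₀ (by positivity) dist_nonneg).1 ?_
  rwa [mul_pow]

end IsEVIFlow

/-! ### Slope estimates along the flow. -/

namespace IsEVIFlow

variable {X : Type*} [MetricSpace X] {E : X → EReal} {lam : ℝ} {u v : ℝ → X} {x y : X}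

/-- Divide the integrated EVI by `h` and let h → 0 along the times in the hypothesis. The difference
d²(x,z) - d²(u_h,z) is at most Lh(d(x,z) + d(u_h,z)) by the triangle inequality. -/
theorem energy_sub_le_of_frequently (hE : IsEVIFunctional E) (hu : IsEVIFlow E lam u x)
    (hx : E x ≠ ⊤) {L : ℝ} (hf : ∃ᶠ h in 𝓝[>] (0 : ℝ), dist x (u h) ≤ L * h) {z : X}
    (hz : E z ≠ ⊤) :
    (E x).toReal - (E z).toReal ≤ L * dist x z - lam / 2 * dist x z ^ 2 := by
  set S : Set ℝ := {h | dist x (u h) ≤ L * h} with hS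
  have hne : (𝓝[>] (0 : ℝ) ⊓ 𝓟 S).NeBot := frequently_mem_iff_neBot.1 hf
  have hle : 𝓝[>] (0 : ℝ) ⊓ 𝓟 S ≤ 𝓝[>] 0 := inf_le_left
  have t1 : Tendsto (fun h => (1 - Real.exp (lam * h)) / h) (𝓝[>] (0 : ℝ)) (𝓝 (-lam)) := by
    have he : HasDerivAt (fun r => Real.exp (lam * r)) lam 0 := by
      simpa using ((hasDerivAt_id (0 : ℝ)).const_mul lam).exp
    have := he.tendsto_slope.mono_left
      (nhdsWithin_mono 0 (fun t ht => ne_of_gt (mem_Ioi.1 ht)))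
    refine this.neg.congr fun h => ?_
    simp only [slope_def_field, mul_zero, Real.exp_zero, sub_zero]
    ring
  have t2 := hu.tendsto_energy hE hx
  have t3 : Tendsto (fun h => dist (u h) z) (𝓝[>] (0 : ℝ)) (𝓝 (dist x z)) :=
    hu.starts.dist tendsto_const_nhds
  have lhs := ((tendsto_expPrimitive_div lam).const_mul 2).mul (t2.sub_const (E z).toReal)
  have rhs := ((t3.const_add (dist x z)).const_mul L).add (t1.mul (t3.pow 2))
  have := le_of_tendsto_of_tendsto (lhs.mono_left hle) (rhs.mono_left hle) (by
    have h0 : ∀ᶠ h in 𝓝[>] (0 : ℝ) ⊓ 𝓟 S, h ∈ Ioi (0 : ℝ) := hle self_mem_nhdsWithin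
    filter_upwards [h0, mem_inf_of_right (mem_principal_self S)] with h hpos hhS
    have hpos : 0 < h := hpos
    have hhS : dist x (u h) ≤ L * h := hhS
    have key := hu.exp_mul_dist_sq_sub_le hE hz hpos
    have tri := dist_triangle x (u h) z
    have d1 : 0 ≤ dist x z := dist_nonneg
    have d2 : 0 ≤ dist (u h) z := dist_nonneg
    have e1 : 2 * (expPrimitive lam h / h) * ((E (u h)).toReal - (E z).toReal) =
        2 * expPrimitive lam h * ((E (u h)).toReal - (E z).toReal) / h := by ring
    rw [e1, div_le_iff₀ hpos]
    have e2 : (L * (dist x z + dist (u h) z) +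
        (1 - Real.exp (lam * h)) / h * dist (u h) z ^ 2) * h =
        L * h * (dist x z + dist (u h) z) + (1 - Real.exp (lam * h)) * dist (u h) z ^ 2 := by
      field_simp
    rw [e2]
    have e3 : dist x z ^ 2 - dist (u h) z ^ 2 ≤ L * h * (dist x z + dist (u h) z) := by
      rw [sq_sub_sq, mul_comm]
      exact mul_le_mul_of_nonneg_right (by linarith) (by positivity)
    nlinarith)
  linarith

theorem metricSlope_le_of_frequently (hE : IsEVIFunctional E) (hu : IsEVIFlow E lam u x)
    (hx : E x ≠ ⊤) {L : ℝ} (hf : ∃ᶠ h in 𝓝[>] (0 : ℝ), dist x (u h) ≤ L * h) :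
    metricSlope E x ≤ ENNReal.ofReal L := by
  rw [metricSlope, if_neg hx]
  refine ENNReal.le_of_forall_pos_le_add fun η hη _ => ?_
  rw [← ENNReal.ofReal_coe_nnreal]
  refine le_trans ?_ (ENNReal.ofReal_add_le (p := L) (q := (η : ℝ)))
  refine limsup_le_of_le (by isBoundedDefault) ?_
  have hball : ∀ᶠ z in 𝓝[≠] x, |lam| / 2 * dist x z < η := by
    refine mem_nhdsWithin_of_mem_nhds ?_
    have : Tendsto (fun z => |lam| / 2 * dist x z) (𝓝 x) (𝓝 (|lam| / 2 * dist x x)) :=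
      Continuous.tendsto (by fun_prop) x
    rw [dist_self, mul_zero] at this
    exact this.eventually (gt_mem_nhds (by exact_mod_cast hη))
  filter_upwards [hball, self_mem_nhdsWithin] with z hz hne
  have hpos : 0 < dist x z := dist_pos.2 (Ne.symm hne)
  by_cases hzt : E z = ⊤
  · rw [hzt, EReal.sub_top, EReal.toENNReal_of_nonpos bot_le, ENNReal.zero_div]
    exact zero_le
  · have key := hu.energy_sub_le_of_frequently hE hx hf hzt
    have hsub : (E x - E z).toENNReal = ENNReal.ofReal ((E x).toReal - (E z).toReal) := by
      conv_lhs => rw [← hE.coe_toReal hx, ← hE.coe_toReal hzt, ← EReal.coe_sub]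
      rw [EReal.toENNReal_of_ne_top (EReal.coe_ne_top _), EReal.toReal_coe]
    rw [hsub, edist_dist, ← ENNReal.ofReal_div_of_pos hpos]
    refine ENNReal.ofReal_le_ofReal ?_
    rw [div_le_iff₀ hpos]
    have : -lam / 2 * dist x z ≤ |lam| / 2 * dist x z := by
      gcongr; exact neg_le_abs lam
    nlinarith

theorem metricSlope_le_metricSpeed (hE : IsEVIFunctional E) (hu : IsEVIFlow E lam u x) {t : ℝ}
    (ht : 0 < t) {γ : ℝ → X} (hγ : ∀ s, 0 < s → γ s = u s) :
    metricSlope E (u t) ≤ metricSpeed γ t := by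
  refine le_of_forall_gt fun c hc => ?_
  obtain ⟨c', hc1, hc2⟩ := exists_between hc
  refine lt_of_le_of_lt ?_ hc2
  have hctop : c' ≠ ⊤ := ne_top_of_lt hc2
  have hev := eventually_lt_of_limsup_lt hc1
  have htend : Tendsto (fun h => h + t) (𝓝[>] (0 : ℝ)) (𝓝[≠] t) := by
    refine tendsto_nhdsWithin_iff.2 ⟨?_, ?_⟩
    · have : Tendsto (fun h => h + t) (𝓝 (0 : ℝ)) (𝓝 (0 + t)) :=
        Continuous.tendsto (by fun_prop) 0
      rw [zero_add] at this
      exact this.mono_left nhdsWithin_le_nhds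
    · filter_upwards [self_mem_nhdsWithin] with h hh
      simpa using ne_of_gt (mem_Ioi.1 hh)
  rw [← ENNReal.ofReal_toReal hctop]
  refine (hu.shift ht).metricSlope_le_of_frequently hE (hu.energy_ne_top hE ht)
    (Eventually.frequently ?_)
  filter_upwards [htend.eventually hev, self_mem_nhdsWithin] with h hh hpos
  have hpos : 0 < h := hpos
  rw [hγ _ (by linarith), hγ t ht, edist_dist, edist_dist, Real.dist_eq, add_sub_cancel_right,
    abs_of_pos hpos, ← ENNReal.ofReal_div_of_pos hpos] at hh
  have h1 := (ENNReal.ofReal_lt_iff_lt_toReal (by positivity) hctop).1 hh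
  rw [div_lt_iff₀ hpos] at h1
  rw [dist_comm]
  exact h1.le

theorem arcJoined (hE : IsEVIFunctional E) (hu : IsEVIFlow E lam u x) (hx : E x ≠ ⊤) {h : ℝ}
    (hh : 0 < h) (hh1 : h ≤ 1) :
    ArcJoined (fun p => metricSlope E p ^ 2) x (u h) h
      (2 * Real.exp (2 * |lam|) * ((E x).toReal - (E (u h)).toReal)) := by
  -- A flow carries no information at time 0, so the starting point is inserted by hand.
  let γ : ℝ → X := fun t => if 0 < t then u t else x
  have hγ : ∀ t, 0 < t → γ t = u t := fun t ht => if_pos ht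
  have hγ0 : γ 0 = x := if_neg (lt_irrefl 0)
  set K := 2 * Real.exp (2 * |lam|) with hK
  have key : ∀ s ∈ Icc 0 h, ∀ t ∈ Icc 0 h, s < t → dist (γ s) (γ t) ^ 2 ≤
      (t - s) * (-K * (E (γ t)).toReal - -K * (E (γ s)).toReal) := by
    intro s hs t ht hst
    rw [hγ t (hs.1.trans_lt hst)]
    rcases hs.1.eq_or_lt with rfl | hs0
    · rw [hγ0]
      have := hu.dist_sq_le hE hx hst (ht.2.trans hh1)
      linarith
    · rw [hγ s hs0]
      have := (hu.shift hs0).dist_sq_le hE (hu.energy_ne_top hE hs0) (sub_pos.2 hst)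
        (by linarith [ht.2])
      simp only [sub_add_cancel] at this
      linarith
  have harc : IsArc γ (fun t => -K * (E (γ t)).toReal) 0 h := by
    intro s hs t ht
    rcases lt_trichotomy s t with hst | rfl | hst
    · exact key s hs t ht hst
    · simp
    · have := key t ht s hs hst
      rw [dist_comm]
      linarith
  refine ⟨hh.le, γ, _, harc, hγ0, hγ h hh, ?_, ?_⟩
  · rw [hγ h hh, hγ0]
    linarith
  · refine ne_top_of_le_ne_top ENNReal.ofReal_ne_top
      (le_trans ?_ (harc.lintegral_metricSpeed_sq_le hh.le))
    refine lintegral_mono_ae ?_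
    rw [← restrict_Ioo_eq_restrict_Icc, ae_restrict_iff' measurableSet_Ioo]
    refine Eventually.of_forall fun t ht => ?_
    rw [hγ t ht.1]
    refine pow_le_pow_left' ?_ 2
    exact hu.metricSlope_le_metricSpeed hE ht.1 hγ

/-- Cut `[h/2, h]` into `n + 1` steps of length δ. Contraction compares d(u_h, u_{h+δ}) with the
displacement in every step, and each squared displacement is at most a constant times δ times the
energy drop. The drops telescope, and n + 1 = h/(2δ) yields a displacement of order δ. -/
theorem metricSlope_le_sqrt (hE : IsEVIFunctional E) (hu : IsEVIFlow E lam u x) {h : ℝ}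
    (hh : 0 < h) (hh1 : h ≤ 1) :
    metricSlope E (u h) ≤ ENNReal.ofReal (Real.sqrt (Real.exp (2 * |lam|) *
      (2 * Real.exp (2 * |lam|)) * (2 / h) * ((E (u (h / 2))).toReal - (E (u h)).toReal))) := by
  set C := Real.exp (2 * |lam|) * (2 * Real.exp (2 * |lam|)) with hC
  set Δ := (E (u (h / 2))).toReal - (E (u h)).toReal with hΔ
  refine (hu.shift hh).metricSlope_le_of_frequently hE (hu.energy_ne_top hE hh) ?_
  have htend : Tendsto (fun n : ℕ => h / 2 / ((n : ℝ) + 1)) atTop (𝓝[>] 0) := by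
    refine tendsto_nhdsWithin_iff.2 ⟨?_, Eventually.of_forall fun n => ?_⟩
    · exact tendsto_const_nhds.div_atTop (tendsto_natCast_atTop_atTop.atTop_add tendsto_const_nhds)
    · exact mem_Ioi.2 (by positivity)
  refine htend.frequently (Eventually.frequently (Eventually.of_forall fun n => ?_))
  set δ := h / 2 / ((n : ℝ) + 1) with hδ
  have hδ0 : 0 < δ := by positivity
  have hδn : ((n : ℝ) + 1) * δ = h / 2 := by rw [hδ]; field_simp
  have hδ1 : δ ≤ 1 := by nlinarith [(Nat.cast_nonneg n : (0 : ℝ) ≤ n)]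
  set D := dist (u h) (u (δ + h)) with hD
  let f : ℕ → ℝ := fun i => (E (u (h / 2 + i * δ))).toReal
  have hstep : ∀ i ∈ Finset.range (n + 1), D ^ 2 ≤ C * δ * (f i - f (i + 1)) := by
    intro i hi
    have hi' : (i : ℝ) ≤ n := by exact_mod_cast Nat.lt_succ_iff.1 (Finset.mem_range.1 hi)
    have hi0 : (0 : ℝ) ≤ i := Nat.cast_nonneg i
    set s := h / 2 + i * δ with hs
    have hs0 : 0 < s := by positivity
    have hsh : 0 < h - s := by nlinarith
    have c1 := (hu.shift hs0).exp_mul_dist_le hE (hu.shift (a := δ + s) (by positivity)) hsh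
    simp only [sub_add_cancel] at c1
    rw [show h - s + (δ + s) = δ + h by ring] at c1
    have c2 := (hu.shift hs0).dist_sq_le hE (hu.energy_ne_top hE hs0) hδ0 hδ1
    have c3 : Real.exp (-|lam|) ≤ Real.exp (lam * (h - s)) := by
      refine Real.exp_le_exp.2 ?_
      have : |lam * (h - s)| ≤ |lam| := by
        rw [abs_mul, abs_of_pos hsh]
        exact mul_le_of_le_one_right (abs_nonneg _) (by linarith)
      linarith [neg_abs_le (lam * (h - s))]
    have c4 : Real.exp (-|lam|) * D ≤ dist (u s) (u (δ + s)) :=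
      le_trans (by gcongr) c1
    have c5 : D ^ 2 ≤ Real.exp (2 * |lam|) * dist (u s) (u (δ + s)) ^ 2 := by
      calc D ^ 2 = Real.exp (2 * |lam|) * (Real.exp (-|lam|) * D) ^ 2 := by
            rw [mul_pow, ← mul_assoc, ← Real.exp_nat_mul, ← Real.exp_add]
            simp
        _ ≤ _ := by gcongr
    have c6 : f (i + 1) = (E (u (δ + s))).toReal := by
      simp only [f, hs]
      congr 3
      push_cast
      ring
    calc D ^ 2 ≤ _ := c5
      _ ≤ Real.exp (2 * |lam|) * (2 * Real.exp (2 * |lam|) *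
          (δ * ((E (u s)).toReal - (E (u (δ + s))).toReal))) := by gcongr
      _ = _ := by rw [c6, hC]; ring
  have hsum := Finset.sum_le_sum hstep
  rw [Finset.sum_const, Finset.card_range, ← Finset.mul_sum, Finset.sum_range_sub', nsmul_eq_mul]
    at hsum
  have hf0 : f 0 = (E (u (h / 2))).toReal := by simp [f]
  have hf1 : f (n + 1) = (E (u h)).toReal := by
    simp only [f]
    push_cast
    rw [hδn, add_halves]
  rw [hf0, hf1] at hsum
  push_cast at hsum
  have hD2 : D ^ 2 ≤ C * (2 / h) * Δ * δ ^ 2 := by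
    have h1 : C * (2 / h) * Δ * δ ^ 2 = C * δ * Δ / ((n : ℝ) + 1) := by
      have : δ = (h / 2) / ((n : ℝ) + 1) := hδ
      field_simp
      rw [this]
      field_simp
    rw [h1, le_div_iff₀ (by positivity)]
    linarith
  calc D ≤ Real.sqrt (C * (2 / h) * Δ * δ ^ 2) := Real.le_sqrt_of_sq_le hD2
    _ = Real.sqrt (C * (2 / h) * Δ) * δ := by
      rw [Real.sqrt_mul' _ (sq_nonneg δ), Real.sqrt_sq hδ0.le]

/-- The slope is controlled by the energy drop between times `h/2` and `h`. The upper energy is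
bounded by testing the EVI with a point of the domain; the lower one because contraction keeps the
image bounded. -/
theorem exists_metricSlope_bound (hE : IsEVIFunctional E) {U : X → ℝ → X}
    (hU : ∀ p, IsEVIFlow E lam (U p) p) {h : ℝ} (hh : 0 < h) (hh1 : h ≤ 1) (B : Set X)
    (hB : Bornology.IsBounded B) :
    ∃ M : ℝ≥0∞, M ≠ ⊤ ∧ ∀ p ∈ B, metricSlope E (U p h) ^ 2 ≤ M := by
  rcases isEmpty_or_nonempty X with hX | hX
  · exact ⟨0, ENNReal.zero_ne_top, fun p => (hX.false p).elim⟩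
  obtain ⟨z, hz⟩ := hE.dense_domain.nonempty
  obtain ⟨R, hR⟩ := hB.subset_closedBall z
  have hcontr : ∀ p ∈ B, U p h ∈ Metric.closedBall (U z h) (R / Real.exp (lam * h)) := by
    intro p hp
    rw [Metric.mem_closedBall, le_div_iff₀' (Real.exp_pos _)]
    exact ((hU p).exp_mul_dist_le hE (hU z) hh).trans (hR hp)
  obtain ⟨c, hc⟩ := hE.bounded_below _ (Metric.isBounded_closedBall
    (x := U z h) (r := R / Real.exp (lam * h)))
  have hG := expPrimitive_pos lam (half_pos hh)
  set m := (E z).toReal + R ^ 2 / (2 * expPrimitive lam (h / 2)) - c with hm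
  refine ⟨ENNReal.ofReal (Real.sqrt (Real.exp (2 * |lam|) *
      (2 * Real.exp (2 * |lam|)) * (2 / h) * m)) ^ 2, by simp, fun p hp => ?_⟩
  gcongr
  refine ((hU p).metricSlope_le_sqrt hE hh hh1).trans ?_
  gcongr
  have h1 := (hU p).exp_mul_dist_sq_sub_le hE hz (half_pos hh)
  have h2 : dist p z ^ 2 ≤ R ^ 2 := by
    have := hR hp
    rw [Metric.mem_closedBall] at this
    gcongr
  have h3 : c ≤ (E (U p h)).toReal := by
    have := hc _ (hcontr p hp)
    rw [← hE.coe_toReal ((hU p).energy_ne_top hE hh)] at this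
    exact_mod_cast this
  have h4 : (E (U p (h / 2))).toReal - (E z).toReal ≤ R ^ 2 / (2 * expPrimitive lam (h / 2)) := by
    rw [le_div_iff₀ (by positivity)]
    have : 0 ≤ Real.exp (lam * (h / 2)) * dist (U p (h / 2)) z ^ 2 := by positivity
    nlinarith
  linarith

end IsEVIFlow

/-! ### Approximation by curves of finite Fisher information. -/

section Approximation

variable {X : Type*} [MetricSpace X] {E : X → EReal} {x y : X}

/-- Arcs between points of the domain can be replaced by arcs along which the squared slope is
integrable, at an arbitrarily small cost. -/
theorem ArcJoined.regularize (hE : IsEVIFunctional E) {T A : ℝ} (h : ArcJoined 0 x y T A)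
    (hx : E x ≠ ⊤) (hy : E y ≠ ⊤) {η : ℝ} (hη : 0 < η) :
    ∃ s, 0 < s ∧ s < η ∧ ArcJoined (fun p => metricSlope E p ^ 2) x y (s + T + s) (A + η) := by
  obtain ⟨lam, hlam⟩ := hE.exists_flow
  choose U hU using hlam
  set K := 2 * Real.exp (2 * |lam|) with hK
  have t1 : Tendsto (fun s => Real.exp (-(lam * s)) ^ 2 * A) (𝓝[>] (0 : ℝ)) (𝓝 A) := by
    have : Continuous fun s : ℝ => Real.exp (-(lam * s)) ^ 2 * A := by fun_prop
    simpa using (this.tendsto 0).mono_left nhdsWithin_le_nhds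
  have t2 := ((hU x).tendsto_energy hE hx).const_sub (E x).toReal |>.const_mul K
  have t3 := ((hU y).tendsto_energy hE hy).const_sub (E y).toReal |>.const_mul K
  -- The total cost is that of the two trajectories joining the endpoints to their images and of the
  -- image of the arc under `U s`; it tends to `A`.
  have t4 := (t2.add t1).add t3
  simp only [sub_self, mul_zero, zero_add, add_zero] at t4
  obtain ⟨s, ⟨hs1, hs2, hs3⟩⟩ := ((t4.eventually (gt_mem_nhds (lt_add_of_pos_right A hη))).and
    ((Ioo_mem_nhdsGT (lt_min hη one_pos) : ∀ᶠ s in 𝓝[>] (0 : ℝ), s ∈ Ioo 0 (min η 1)))).exists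
  have hs4 : s ≤ 1 := (hs3.trans_le (min_le_right _ _)).le
  refine ⟨s, hs2, hs3.trans_le (min_le_left _ _), ?_⟩
  have p1 := (hU x).arcJoined hE hx hs2 hs4
  have p3 := ((hU y).arcJoined hE hy hs2 hs4).symm
  have p2 := h.map (g := fun p => metricSlope E p ^ 2) (F := fun p => U p s)
    (K := Real.exp (-(lam * s))) (fun p q => by
      have := (hU p).exp_mul_dist_le hE (hU q) hs2
      rw [Real.exp_neg, ← div_eq_inv_mul, le_div_iff₀ (Real.exp_pos _), mul_comm]
      exact this) (fun B hB => IsEVIFlow.exists_metricSlope_bound hE hU hs2 hs4 B hB)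
  exact ((p1.trans p2).trans p3).mono hs1.le

theorem exists_ne_top_of_setLIntegral_ne_top {f : ℝ → ℝ≥0∞} {s : Set ℝ} {a b : ℝ} (hab : a < b)
    (hs : Ioo a b ⊆ s) (hf : ∫⁻ t in s, f t ≠ ⊤) : ∃ t ∈ Ioo a b, f t ≠ ⊤ := by
  by_contra! hc
  refine hf (top_le_iff.1 (le_trans ?_ (lintegral_mono_set hs)))
  rw [setLIntegral_congr_fun measurableSet_Ioo hc, setLIntegral_const, Real.volume_Ioo,
    ENNReal.top_mul]
  simpa using hab

theorem energy_ne_top_of_metricSlope {p : X} (h : metricSlope E p ^ 2 ≠ ⊤) : E p ≠ ⊤ := by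
  intro hp
  simp [metricSlope, hp] at h

/-- The slope, hence the energy, is finite at almost every time; continuity of `V` at 0 makes the
cost of an initial piece small. -/
theorem IsArc.exists_arcJoined_left {γ : ℝ → X} {V : ℝ → ℝ} (h : IsArc γ V 0 1)
    (hV : Continuous V) (hg : ∫⁻ t in Icc (0 : ℝ) 1, metricSlope E (γ t) ^ 2 ≠ ⊤) {η : ℝ}
    (hη : 0 < η) : ∃ (τ : ℝ) (p : X), 0 < τ ∧ τ < η ∧ E p ≠ ⊤ ∧
      ArcJoined (fun p => metricSlope E p ^ 2) (γ 0) p τ η := by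
  have hev : ∀ᶠ t in 𝓝 (0 : ℝ), V t < V 0 + η :=
    hV.continuousAt.eventually (gt_mem_nhds (lt_add_of_pos_right _ hη))
  obtain ⟨r, hr, hr'⟩ := Metric.eventually_nhds_iff.1 hev
  have hm : 0 < min r (min η 1) := lt_min hr (lt_min hη one_pos)
  have m1 := min_le_left r (min η 1)
  have m2 : min r (min η 1) ≤ η := (min_le_right _ _).trans (min_le_left _ _)
  have m3 : min r (min η 1) ≤ 1 := (min_le_right _ _).trans (min_le_right _ _)
  obtain ⟨τ, hτ, hfin⟩ := exists_ne_top_of_setLIntegral_ne_top (s := Icc 0 1) hm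
    (fun t ht => ⟨ht.1.le, ht.2.le.trans m3⟩) hg
  have hτ1 : τ ≤ 1 := hτ.2.le.trans m3
  have hsub : Icc 0 τ ⊆ Icc (0 : ℝ) 1 := Icc_subset_Icc le_rfl hτ1
  refine ⟨τ, γ τ, hτ.1, hτ.2.trans_le m2, energy_ne_top_of_metricSlope hfin, ?_⟩
  have hJ := (h.mono hsub).arcJoined (g := fun p => metricSlope E p ^ 2) hτ.1.le
    (ne_top_of_le_ne_top hg (lintegral_mono_set hsub))
  rw [sub_zero] at hJ
  refine hJ.mono ?_
  have := hr' (y := τ) (by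
    rw [Real.dist_eq, sub_zero, abs_of_pos hτ.1]; exact hτ.2.trans_le m1)
  linarith

theorem IsArc.exists_arcJoined_right {γ : ℝ → X} {V : ℝ → ℝ} (h : IsArc γ V 0 1)
    (hV : Continuous V) (hg : ∫⁻ t in Icc (0 : ℝ) 1, metricSlope E (γ t) ^ 2 ≠ ⊤) {η : ℝ}
    (hη : 0 < η) : ∃ (τ : ℝ) (p : X), 0 < τ ∧ τ < η ∧ E p ≠ ⊤ ∧
      ArcJoined (fun p => metricSlope E p ^ 2) (γ 1) p τ η := by
  have hm : MapsTo (fun t => -1 * t + 1) (Icc (0 : ℝ) 1) (Icc 0 1) := fun t ht =>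
    ⟨by linarith [ht.2], by linarith [ht.1]⟩
  have := (h.comp_affine hm).exists_arcJoined_left (by fun_prop)
    (setLIntegral_comp_affine_ne_top (f := fun t => metricSlope E (γ t) ^ 2) (by norm_num) hm hg) hη
  simpa using this

theorem exists_curve_kineticAction_lt (hE : IsEVIFunctional E) {γ₀ γ : Curve X}
    (hγ₀ : γ₀.Joins x y) (hA₀ : kineticAction γ₀ ≠ ⊤) (hI₀ : fisherInformation E γ₀ ≠ ⊤)
    (hγ : γ.Joins x y) {c : ℝ≥0∞} (hc : kineticAction γ < c) :
    ∃ ω : Curve X, ω.Joins x y ∧ kineticAction ω < c ∧ fisherInformation E ω ≠ ⊤ := by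
  have hext : ∀ ω : Curve X, ω.ext 0 = ω 0 ∧ ω.ext 1 = ω 1 := fun ω => by
    simp [Curve.ext, IccExtend, projIcc_left, projIcc_right]
  obtain ⟨V₀, h1, h2, -⟩ := exists_isArc_of_kineticAction_ne_top hA₀
  have hAγ : kineticAction γ ≠ ⊤ := ne_top_of_lt hc
  obtain ⟨V, h4, -, h6⟩ := exists_isArc_of_kineticAction_ne_top hAγ
  have hg₀ : ∫⁻ t in Icc (0 : ℝ) 1, metricSlope E (γ₀.ext t) ^ 2 ≠ ⊤ := by
    intro h
    simp [fisherInformation, h] at hI₀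
  have hJ : ArcJoined 0 x y 1 (2 * (kineticAction γ).toReal) := by
    have := h4.arcJoined (g := 0) zero_le_one (by simp)
    rwa [h6, sub_zero, (hext γ).1, (hext γ).2, hγ.1, hγ.2] at this
  set A := 2 * (kineticAction γ).toReal with hA
  have key : ∀ η > 0, ∃ T, 0 < T ∧ T < 1 + 6 * η ∧
      ArcJoined (fun p => metricSlope E p ^ 2) x y T (A + 5 * η) := by
    intro η hη
    obtain ⟨τ, p, hτ, hτη, hp, hxp⟩ := h1.exists_arcJoined_left h2 hg₀ hη
    obtain ⟨τ', q, hτ', hτη', hq, hyq⟩ := h1.exists_arcJoined_right h2 hg₀ hη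
    rw [(hext γ₀).1, hγ₀.1] at hxp
    rw [(hext γ₀).2, hγ₀.2] at hyq
    -- The regularized arc runs from `p` back to `x`, along `γ` to `y`, and on to `q`. The end
    -- pieces are traversed twice, once regularized and once as they are: four costs `η`, plus one
    -- for the regularization.
    obtain ⟨s, hs, hsη, hreg⟩ :=
      ((hxp.forget.symm.trans hJ).trans hyq.forget).regularize hE hp hq hη
    have := (hxp.trans hreg).trans hyq.symm
    exact ⟨_, by linarith, by linarith, this.mono (by linarith)⟩
  have hA0 : 0 ≤ A := by positivity
  have hlim : Tendsto (fun η : ℝ => ENNReal.ofReal ((1 + 6 * η) * (A + 5 * η) / 2)) (𝓝[>] 0)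
      (𝓝 (kineticAction γ)) := by
    have : Continuous fun η : ℝ => (1 + 6 * η) * (A + 5 * η) / 2 := by fun_prop
    have := ENNReal.tendsto_ofReal ((this.tendsto 0).mono_left
      (nhdsWithin_le_nhds (s := Ioi (0 : ℝ))))
    simpa [hA, ENNReal.ofReal_toReal hAγ] using this
  obtain ⟨η, hη1, hη2⟩ := ((hlim.eventually (gt_mem_nhds hc)).and self_mem_nhdsWithin).exists
  have hη2 : 0 < η := hη2
  obtain ⟨T, hT, hT', hT2⟩ := key η hη2
  obtain ⟨ω, hω1, hω2, hω3⟩ := (hT2.rescale hT).exists_curve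
  refine ⟨ω, hω1, hω2.trans_lt (lt_of_le_of_lt (ENNReal.ofReal_le_ofReal ?_) hη1), hω3⟩
  gcongr

theorem kineticCost_le_schrodingerCost (E : X → EReal) (ε : ℝ) (x y : X) :
    kineticCost x y ≤ schrodingerCost E ε x y :=
  iInf₂_mono fun _ _ => le_self_add

theorem tendsto_schrodingerCost (hE : IsEVIFunctional E)
    (hsolv : ∃ ε : ℝ, 0 < ε ∧ SchrodingerSolvable E ε x y) {ε : ℕ → ℝ}
    (hε : Tendsto ε atTop (𝓝 0)) :
    Tendsto (fun k => schrodingerCost E (ε k) x y) atTop (𝓝 (kineticCost x y)) := by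
  obtain ⟨ε₀, hε₀, hfin, γ₀, hγ₀, hmin⟩ := hsolv
  rw [← hmin, schrodingerAction] at hfin
  obtain ⟨hA₀, hI₀⟩ := ENNReal.add_ne_top.1 hfin
  have hI₀ : fisherInformation E γ₀ ≠ ⊤ := by
    intro h
    rw [h, ENNReal.mul_top (by simpa using hε₀.ne')] at hI₀
    exact hI₀ rfl
  rw [tendsto_order]
  refine ⟨fun a ha => Eventually.of_forall fun k =>
    ha.trans_le (kineticCost_le_schrodingerCost E (ε k) x y), fun a ha => ?_⟩
  obtain ⟨γ, hγ, hγa⟩ : ∃ γ : Curve X, γ.Joins x y ∧ kineticAction γ < a := by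
    simpa [kineticCost, iInf_lt_iff] using ha
  obtain ⟨ω, hω, hωa, hωI⟩ := exists_curve_kineticAction_lt hE hγ₀ hA₀ hI₀ hγ hγa
  have hlim : Tendsto (fun k => schrodingerAction E (ε k) ω) atTop (𝓝 (kineticAction ω)) := by
    have h1 : Tendsto (fun k => ENNReal.ofReal (ε k ^ 2)) atTop (𝓝 0) := by
      simpa using ENNReal.tendsto_ofReal (hε.pow 2)
    have h2 := ENNReal.Tendsto.mul_const h1 (Or.inr hωI)
    simpa [schrodingerAction] using h2.const_add (kineticAction ω)
  filter_upwards [hlim.eventually (gt_mem_nhds hωa)] with k hk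
  exact lt_of_le_of_lt (iInf₂_le ω hω) hk

end Approximation

/-! ### Compactness of curves of bounded action. -/

/-- Cantor's diagonal argument: if every subsequence of each `u i` has a further subsequence
converging in the sense of `F i`, then a single subsequence works for all `i`. -/
theorem exists_strictMono_forall_tendsto {α ι : Type*} (u : ℕ → ℕ → α) (F : ℕ → ι → Filter α)
    (h : ∀ (i : ℕ) (φ : ℕ → ℕ), StrictMono φ →
      ∃ (z : ι) (ψ : ℕ → ℕ), StrictMono ψ ∧ Tendsto (fun n => u i (φ (ψ n))) atTop (F i z)) :
    ∃ φ : ℕ → ℕ, StrictMono φ ∧ ∀ i, ∃ z, Tendsto (fun n => u i (φ n)) atTop (F i z) := by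
  choose! z ψ hψ hlim using h
  let Φ : ℕ → ℕ → ℕ := fun n => Nat.rec (ψ 0 id) (fun n φ => φ ∘ ψ (n + 1) φ) n
  have hsucc : ∀ n, Φ (n + 1) = Φ n ∘ ψ (n + 1) (Φ n) := fun n => rfl
  have hmono : ∀ n, StrictMono (Φ n) := by
    intro n
    induction n with
    | zero => exact hψ 0 id strictMono_id
    | succ n ih => rw [hsucc]; exact ih.comp (hψ _ _ ih)
  have hconv : ∀ i, ∃ w, Tendsto (fun n => u i (Φ i n)) atTop (F i w) := by
    intro i
    cases i with
    | zero => exact ⟨_, hlim 0 id strictMono_id⟩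
    | succ n => exact ⟨_, hlim (n + 1) (Φ n) (hmono n)⟩
  have hfactor : ∀ i k, ∃ θ : ℕ → ℕ, StrictMono θ ∧ Φ (i + k) = Φ i ∘ θ := by
    intro i k
    induction k with
    | zero => exact ⟨id, strictMono_id, rfl⟩
    | succ k ih =>
      obtain ⟨θ, hθ, he⟩ := ih
      refine ⟨θ ∘ ψ (i + k + 1) (Φ (i + k)), hθ.comp (hψ _ _ (hmono _)), ?_⟩
      rw [← add_assoc, hsucc, ← Function.comp_assoc, ← he]
  refine ⟨fun n => Φ n n, strictMono_nat_of_lt_succ fun n => ?_, fun i => ?_⟩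
  · rw [hsucc]
    exact hmono n (lt_of_lt_of_le n.lt_succ_self ((hψ _ _ (hmono n)).le_apply))
  · obtain ⟨w, hw⟩ := hconv i
    choose θ hθ he using hfactor i
    refine ⟨w, ?_⟩
    -- From index `i` on, the diagonal is `Φ i` evaluated along these indices, so it inherits the
    -- limit of the `i`-th extraction.
    have hκ : Tendsto (fun n => θ (n - i) n) atTop atTop :=
      tendsto_atTop_mono (fun n => (hθ (n - i)).le_apply) tendsto_id
    refine (hw.comp hκ).congr' ?_
    filter_upwards [eventually_ge_atTop i] with n hn
    have := congrFun (he (n - i)) n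
    rw [Nat.add_sub_of_le hn] at this
    simp [this]

/-- A Hölder continuous map on the unit interval is a curve. -/
theorem exists_curve_of_dist_le_sqrt {X : Type*} [MetricSpace X] {Ω : unitInterval → X} {C : ℝ}
    (h : ∀ s t, dist (Ω s) (Ω t) ≤ Real.sqrt (C * dist s t)) :
    ∃ γ : Curve X, ∀ t, γ t = Ω t := by
  refine ⟨⟨Ω, continuous_iff_continuousAt.2 fun t => ?_⟩, fun _ => rfl⟩
  refine tendsto_iff_dist_tendsto_zero.2 (squeeze_zero (fun _ => dist_nonneg) (fun s => h s t) ?_)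
  have : Tendsto (fun s => Real.sqrt (C * dist s t)) (𝓝 t) (𝓝 (Real.sqrt (C * dist t t))) :=
    Continuous.tendsto (by fun_prop) t
  simpa using this

section Compactness

variable {X : Type*} [MetricSpace X] {E : X → EReal} {σ : TopologicalSpace X}

theorem IsAdmissibleTopology.eventually_lt_dist (hσ : IsAdmissibleTopology E σ) {p q : ℕ → X}
    {a b : X} (hp : Tendsto p atTop (@nhds X σ a)) (hq : Tendsto q atTop (@nhds X σ b)) {r : ℝ}
    (hr : r < dist a b) : ∀ᶠ n in atTop, r < dist (p n) (q n) := by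
  rcases lt_or_ge r 0 with h0 | h0
  · exact Eventually.of_forall fun n => h0.trans_le dist_nonneg
  have h1 : ENNReal.ofReal r < liminf (fun n => edist (p n) (q n)) atTop := by
    refine lt_of_lt_of_le ?_ (hσ.dist_lsc p q a b hp hq)
    rw [edist_dist]
    exact (ENNReal.ofReal_lt_ofReal_iff_of_nonneg h0).2 hr
  filter_upwards [eventually_lt_of_lt_liminf h1] with n hn
  rw [edist_dist] at hn
  exact (ENNReal.ofReal_lt_ofReal_iff_of_nonneg h0).1 hn

theorem IsAdmissibleTopology.dist_le (hσ : IsAdmissibleTopology E σ) {p q : ℕ → X}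
    {a b : X} (hp : Tendsto p atTop (@nhds X σ a)) (hq : Tendsto q atTop (@nhds X σ b)) {r : ℝ}
    (hr : ∀ n, dist (p n) (q n) ≤ r) : dist a b ≤ r := by
  by_contra! hc
  obtain ⟨n, hn⟩ := (hσ.eventually_lt_dist hp hq hc).exists
  exact absurd (hr n) (not_le.2 hn)

/-- Equi-Hölder curves through a common point have a subsequence converging at all times. -/
theorem IsAdmissibleTopology.exists_subseq (hσ : IsAdmissibleTopology E σ)
    {ω : ℕ → unitInterval → X} {x : X} {C : ℝ} (hx : ∀ k, ω k 0 = x)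
    (hω : ∀ k s t, dist (ω k s) (ω k t) ≤ Real.sqrt (C * dist s t)) :
    ∃ φ : ℕ → ℕ, StrictMono φ ∧
      ∀ t, ∃ z, Tendsto (fun n => ω (φ n) t) atTop (@nhds X σ z) := by
  have hbdd : ∀ (t : unitInterval) (φ : ℕ → ℕ),
      Bornology.IsBounded (range fun n => ω (φ n) t) := by
    intro t φ
    refine (Metric.isBounded_closedBall (x := x) (r := Real.sqrt (C * dist t 0))).subset ?_
    rintro _ ⟨n, rfl⟩
    rw [Metric.mem_closedBall, ← hx (φ n)]
    exact hω _ _ _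
  let D : ℕ → unitInterval := TopologicalSpace.denseSeq unitInterval
  obtain ⟨φ, hφ, hlim⟩ := exists_strictMono_forall_tendsto (fun i n => ω n (D i))
    (fun _ z => @nhds X σ z) (fun i φ _ => hσ.bounded_seq_compact _ (hbdd (D i) φ))
  choose zD hzD using hlim
  refine ⟨φ, hφ, fun t => ?_⟩
  obtain ⟨z, ψ, hψ, hz⟩ := hσ.bounded_seq_compact _ (hbdd t φ)
  refine ⟨z, tendsto_of_subseq_tendsto fun ns hns => ?_⟩
  obtain ⟨z', ms, hms, hz'⟩ := hσ.bounded_seq_compact _ (hbdd t (φ ∘ ns))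
  refine ⟨ms, ?_⟩
  -- Two cluster points at time `t` are compared through the limit at a dense time `r`, by lower
  -- semicontinuity and the Hölder bound; letting `r = t` makes them equal.
  have hle : ∀ r : unitInterval, dist z z' ≤ 2 * Real.sqrt (C * dist t r) := by
    refine isClosed_property (TopologicalSpace.denseRange_denseSeq unitInterval)
      (isClosed_le continuous_const (by fun_prop)) fun i => ?_
    have h1 := hσ.dist_le hz ((hzD i).comp hψ.tendsto_atTop) fun n => hω _ _ _
    have h2 := hσ.dist_le hz' ((hzD i).comp (hns.comp hms.tendsto_atTop)) fun n => hω _ _ _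
    calc dist z z' ≤ dist z (zD i) + dist z' (zD i) := dist_triangle_right _ _ _
      _ ≤ _ := by rw [two_mul]; exact add_le_add h1 h2
  have h0 : dist z z' ≤ 0 := by simpa using hle t
  rw [dist_le_zero.1 h0]
  exact hz'

/-- The increment inequality passes to the limit: the distance is σ-lower semicontinuous and the
normalized control functions converge along an ultrafilter, so the limit curve has a control
function of total increment `2 * m`. -/
theorem exists_limit_curve (hσ : IsAdmissibleTopology E σ) {x y : X} {ω : ℕ → Curve X}
    (hω : ∀ k, (ω k).Joins x y) {m : ℝ≥0∞} (hm : m ≠ ⊤)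
    (hlim : Tendsto (fun k => kineticAction (ω k)) atTop (𝓝 m)) :
    ∃ (ω₀ : Curve X) (φ : ℕ → ℕ), StrictMono φ ∧
      PointwiseTendsto σ (fun k => ω (φ k)) ω₀ ∧ ω₀.Joins x y ∧ kineticAction ω₀ ≤ m := by
  have hT2 := hσ.hausdorff
  -- The first `k₀` curves are discarded, as their action may be infinite.
  obtain ⟨k₀, hk₀⟩ := eventually_atTop.1 (hlim.eventually (gt_mem_nhds
    (ENNReal.lt_add_right hm one_ne_zero)))
  have hfin : ∀ k, kineticAction (ω (k + k₀)) < m + 1 := fun k => hk₀ _ (Nat.le_add_left _ _)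
  have hmtop : m + 1 ≠ ⊤ := ENNReal.add_ne_top.2 ⟨hm, ENNReal.one_ne_top⟩
  choose V hV _ hVA using fun k =>
    exists_isArc_of_kineticAction_ne_top (ne_top_of_lt (hfin k))
  set C := 2 * (m + 1).toReal with hC
  have hVC : ∀ k, V k 1 - V k 0 ≤ C := fun k => by
    rw [hVA, hC]
    have := ENNReal.toReal_mono hmtop (hfin k).le
    linarith
  have hext : ∀ (γ : Curve X) (t : unitInterval), γ.ext t = γ t := fun γ t => by
    simp [Curve.ext]
  have hmem0 : (0 : ℝ) ∈ Icc (0 : ℝ) 1 := left_mem_Icc.2 zero_le_one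
  have hmem1 : (1 : ℝ) ∈ Icc (0 : ℝ) 1 := right_mem_Icc.2 zero_le_one
  have hVmem : ∀ k, ∀ t ∈ Icc (0 : ℝ) 1, V k t - V k 0 ∈ Icc 0 C := by
    intro k t ht
    have h1 := (hV k).monotoneOn hmem0 ht ht.1
    have h2 := (hV k).monotoneOn ht hmem1 ht.2
    exact ⟨by linarith, by linarith [hVC k]⟩
  have hholder : ∀ k (s t : unitInterval),
      dist (ω (k + k₀) s) (ω (k + k₀) t) ≤ Real.sqrt (C * dist s t) := by
    intro k s t
    refine Real.le_sqrt_of_sq_le ?_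
    have h1 := hV k s s.2 t t.2
    rw [hext, hext] at h1
    refine h1.trans ((le_abs_self _).trans ?_)
    rw [abs_mul, mul_comm, dist_comm, Subtype.dist_eq, Real.dist_eq]
    gcongr
    have h2 := hVmem k s s.2
    have h3 := hVmem k t t.2
    exact abs_le.2 ⟨by linarith [h2.2, h3.1], by linarith [h2.1, h3.2]⟩
  obtain ⟨φ, hφ, hconv⟩ := hσ.exists_subseq (ω := fun k => ω (k + k₀))
    (fun k => (hω (k + k₀)).1) hholder
  choose Ω hΩ using hconv
  obtain ⟨ω₀, hω₀⟩ := exists_curve_of_dist_le_sqrt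
    fun s t => hσ.dist_le (hΩ s) (hΩ t) fun n => hholder (φ n) s t
  have hshift : Tendsto (fun n => φ n + k₀) atTop atTop :=
    tendsto_atTop_mono (fun n => Nat.le_add_right _ _) hφ.tendsto_atTop
  have hlim' : Tendsto (fun n => kineticAction (ω (φ n + k₀))) atTop (𝓝 m) := hlim.comp hshift
  -- An ultrafilter gives limits of the bounded control functions at all times at once, in place of
  -- Helly's selection theorem.
  have hU : (hyperfilter ℕ : Filter ℕ) ≤ atTop := Nat.hyperfilter_le_atTop
  have hWex : ∀ t, t ∈ Icc (0 : ℝ) 1 →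
      ∃ l, Tendsto (fun n => V (φ n) t - V (φ n) 0) (hyperfilter ℕ : Filter ℕ) (𝓝 l) := by
    intro t ht
    have hev : ∀ᶠ n in (hyperfilter ℕ : Filter ℕ), V (φ n) t - V (φ n) 0 ∈ Icc 0 C :=
      Eventually.of_forall fun n => hVmem (φ n) t ht
    obtain ⟨l, -, hl⟩ := isCompact_Icc.ultrafilter_le_nhds
      ((hyperfilter ℕ).map fun n : ℕ => V (φ n) t - V (φ n) 0)
      (le_principal_iff.2 hev)
    exact ⟨l, hl⟩
  choose! W hW using hWex
  have harc : IsArc ω₀.ext W 0 1 := by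
    intro s hs t ht
    have hQ : Tendsto (fun n => (t - s) * (V (φ n) t - V (φ n) s)) (hyperfilter ℕ : Filter ℕ)
        (𝓝 ((t - s) * (W t - W s))) := by
      refine (((hW t ht).sub (hW s hs)).const_mul (t - s)).congr fun n => ?_
      ring
    have hnn : 0 ≤ (t - s) * (W t - W s) :=
      ge_of_tendsto' hQ fun n => (sq_nonneg _).trans (hV (φ n) s hs t ht)
    refine (Real.le_sqrt dist_nonneg hnn).1 (le_of_forall_lt_imp_le_of_dense fun r hr => ?_)
    rcases lt_or_ge r 0 with h0 | h0
    · exact h0.le.trans (Real.sqrt_nonneg _)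
    refine Real.le_sqrt_of_sq_le (ge_of_tendsto hQ (hU ?_))
    have e1 : ω₀.ext s = Ω ⟨s, hs⟩ := (hext ω₀ ⟨s, hs⟩).trans (hω₀ _)
    have e2 : ω₀.ext t = Ω ⟨t, ht⟩ := (hext ω₀ ⟨t, ht⟩).trans (hω₀ _)
    rw [e1, e2] at hr
    filter_upwards [hσ.eventually_lt_dist (hΩ ⟨s, hs⟩) (hΩ ⟨t, ht⟩) hr] with n hn
    refine le_trans ?_ (hV (φ n) s hs t ht)
    rw [hext _ ⟨s, hs⟩, hext _ ⟨t, ht⟩]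
    gcongr
  have hend : (W 1 - W 0) / 2 = m.toReal := by
    have hW0 : W 0 = 0 := tendsto_nhds_unique (hW 0 hmem0) (by simp)
    have h1 : Tendsto (fun n => V (φ n) 1 - V (φ n) 0) atTop (𝓝 (2 * m.toReal)) := by
      simp only [hVA]
      exact ((ENNReal.tendsto_toReal hm).comp hlim').const_mul 2
    have hW1 : W 1 = 2 * m.toReal := tendsto_nhds_unique (hW 1 hmem1) (h1.mono_left hU)
    rw [hW0, hW1]
    ring
  have hunique : ∀ (t : unitInterval) (p : X), (∀ n, ω (φ n + k₀) t = p) → Ω t = p := by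
    intro t p hp
    have h1 : Tendsto (fun n => ω (φ n + k₀) t) atTop (@nhds X σ p) := by
      simp only [hp]
      exact @tendsto_const_nhds _ σ _ p _
    exact @tendsto_nhds_unique X ℕ σ hT2 _ _ _ _ _ (hΩ t) h1
  refine ⟨ω₀, fun n => φ n + k₀, fun a b hab => Nat.add_lt_add_right (hφ hab) k₀,
    fun t => ?_, ⟨(hω₀ 0).trans (hunique 0 x fun n => (hω _).1),
      (hω₀ 1).trans (hunique 1 y fun n => (hω _).2)⟩, ?_⟩
  · simp only [Curve.pos, hω₀]
    exact hΩ t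
  refine (kineticAction_le_of_isArc harc).trans (le_of_eq ?_)
  rw [hend, ENNReal.ofReal_toReal hm]

end Compactness

/-! ### Convergence of values and of minimizers. -/

theorem corollary4p4 {X : Type*} [MetricSpace X] [CompleteSpace X]
    [TopologicalSpace.SeparableSpace X] (E : X → EReal) (hE : IsEVIFunctional E)
    (x y : X) (hsolv : ∃ ε : ℝ, 0 < ε ∧ SchrodingerSolvable E ε x y)
    (σ : TopologicalSpace X) (hσ : IsAdmissibleTopology E σ)
    (ε : ℕ → ℝ) (hε_pos : ∀ k, 0 < ε k) (hε : Tendsto ε atTop (𝓝 0)) :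
    Tendsto (fun k => schrodingerCost E (ε k) x y) atTop (𝓝 (kineticCost x y)) ∧
    ∀ ω : ℕ → Curve X, (∀ k, IsSchrodingerMinimizer E (ε k) x y (ω k)) →
      Tendsto (fun k => kineticAction (ω k) + ENNReal.ofReal (ε k ^ 2) * fisherInformation E (ω k))
        atTop (𝓝 (kineticCost x y)) ∧
      ∃ (ω₀ : Curve X) (φ : ℕ → ℕ), StrictMono φ ∧
        PointwiseTendsto σ (fun k => ω (φ k)) ω₀ ∧
        ω₀.Joins x y ∧ kineticAction ω₀ = kineticCost x y := by
  have hcost := tendsto_schrodingerCost hE hsolv hε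
  refine ⟨hcost, fun ω hω => ?_⟩
  have hact : Tendsto (fun k => kineticAction (ω k) +
      ENNReal.ofReal (ε k ^ 2) * fisherInformation E (ω k)) atTop (𝓝 (kineticCost x y)) :=
    hcost.congr fun k => (hω k).2.symm
  refine ⟨hact, ?_⟩
  have hfin : kineticCost x y ≠ ⊤ := by
    obtain ⟨ε₀, -, h, -⟩ := hsolv
    exact ne_top_of_le_ne_top h (kineticCost_le_schrodingerCost E ε₀ x y)
  -- The kinetic action of each minimizer lies between the kinetic infimum and its full action,
  -- which converges to that infimum.
  have hkin : Tendsto (fun k => kineticAction (ω k)) atTop (𝓝 (kineticCost x y)) :=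
    tendsto_of_tendsto_of_tendsto_of_le_of_le tendsto_const_nhds hact
      (fun k => iInf₂_le (ω k) (hω k).1) (fun k => le_self_add)
  obtain ⟨ω₀, φ, hφ, hconv, hjoin, hle⟩ :=
    exists_limit_curve hσ (fun k => (hω k).1) hfin hkin
  exact ⟨ω₀, φ, hφ, hconv, hjoin, le_antisymm hle (iInf₂_le ω₀ hjoin)⟩
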